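/- **Setting.** Consider $N$ agents $\dot x_i=g_i(x_i,u_i)$, $y_i=h_i(x_i)$, $i=1,\dots,N$, with $x_i\in\mathbb R^{n_i}$, $u_i,y_i\in\mathbb R$ and $g_i,h_i$ smooth, and a weighted undirected graph with adjacency weights $a_{ij}=a_{ji}\ge 0$, $a_{ii}=0$, where $i$ and $j$ are joined by an edge iff $a_{ij}>0$. Agent $i$ has a cost $f_i:\mathbb R\to\mathbb R$ and a datum $d_i^0\in\mathbb R$, which it observes only as $d_i(t)=d_i^0+\sum_{j=1}^{k_i}A_{ij}\sin(\omega_{ij}t+\varphi_{ij})$, with distinct known frequencies $\omega_{ij}>0$ and arbitrary unknown $A_{ij},\varphi_{ij}\in\mathbb R$. The resource-allocation problem is $$\text{minimize }\sum_{i=1}^N f_i(y_i)\quad\text{subject to}\quad \sum_{i=1}^N y_i=\sum_{i=1}^N d_i^0 .$$ **Assumptions.** 1. Each $f_i$ is $C^2$ with $0<\underline h_i\le f_i''(s)\le\overline h_i<\infty$ for all $s\in\mathbb R$. 2. The graph is connected. 3. For each $i$ there are smooth functions ${\bf x}_i,{\bf u}_i$ on $\mathbb R$ such that for every $r\in\mathbb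 R$ the pair $({\bf x}_i(r),{\bf u}_i(r))$ is the unique solution $(x,u)$ of $g_i(x,u)=0$, $h_i(x)=r$; moreover ${\bf u}_i$ is $M_i$-Lipschitz on $\mathbb R$. 4. Let $y^*$ be an optimal solution of the resource-allocation problem, $x_i^*={\bf x}_i(y_i^*)$, $u_i^*={\bf u}_i(y_i^*)$. Each agent is passive with respect to $(x_i^*,u_i^*)$: there are $\alpha_{i1},\alpha_{i2}\in\mathcal K_\infty$ and a $C^1$ function $V_i$ on $\mathbb R^{n_i}$ with $\alpha_{i1}(\|x-x_i^*\|)\le V_i(x)\le\alpha_{i2}(\|x-x_i^*\|)$ and $\nabla V_i(x)^\top g_i(x,u)\le (h_i(x)-y_i^*)(u-u_i^*)$ for all $x\in\mathbb R^{n_i}$, $u\in\mathbb R$. **Controller.** With $S_i=\mathrm{diag}\Big(0,\begin{bmatrix}0&\omega_{i1}\\-\omega_{i1}&0\end{bmatrix},\dots,\begin{bmatrix}0&\omega_{ik_i}\\-\omega_{ik_i}&0\end{bmatrix}\Big)$, $D_i=[1,1,0,\dots,1,0]$ and $D_i^\epsilon=[0,1,0,\dots,1,0]$ (both of length $2k_i+1$),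 let $$\begin{aligned}u_i&=-\gamma f_i'(y_i)+\lambda_i+{\bf u}_i(y_i),\\ \dot\lambda_i&=-\textstyle\sum_j a_{ij}(\lambda_i-\lambda_j)-\sum_j a_{ij}(z_i-z_j)+d_i(t)-y_i-D_i^\epsilon\eta_i,\\ \dot\eta_i&=(S_i-L_iD_i)\eta_i+L_id_i(t),\\ \dot z_i&=\textstyle\sum_j a_{ij}(\lambda_i-\lambda_j),\end{aligned}$$ where $\gamma>\max_i\frac{1+M_i}{\underline h_i}$ and $L_i\in\mathbb R^{2k_i+1}$ is such that $S_i-L_iD_i$ is Hurwitz. Let $\xi_i(t)\in\mathbb R^{2k_i+1}$ be the column vector with first entry $d_i^0$ followed by the pairs $A_{ij}\sin(\omega_{ij}t+\varphi_{ij}),\ A_{ij}\cos(\omega_{ij}t+\varphi_{ij})$, $j=1,\dots,k_i$, so that $\dot\xi_i=S_i\xi_i$ and $d_i=D_i\xi_i$. A point $(\tilde x,\tilde\lambda,\tilde z)$ is called an equilibrium of the closed loop if, with $\tilde y_i=h_i(\tilde x_i)$, for all $i$, $$g_i\big(\tilde x_i,-\gamma f_i'(\tilde y_i)+\tilde\lambda_i+{\bf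 u}_i(\tilde y_i)\big)=0,\qquad -\sum_j a_{ij}(\tilde\lambda_i-\tilde\lambda_j)-\sum_j a_{ij}(\tilde z_i-\tilde z_j)+d_i^0-\tilde y_i=0,\qquad \sum_j a_{ij}(\tilde\lambda_i-\tilde\lambda_j)=0;$$ the corresponding steady-state motion of the closed loop is $(x,\lambda,\eta,z)(t)=(\tilde x,\tilde\lambda,\xi(t),\tilde z)$. **Theorem.** Under assumptions 1–3 and with such $\gamma$ and $L_i$, the resource-allocation problem has exactly one optimal solution $y^*$. If moreover assumption 4 holds, then: (a) For every initial value of $(x,\lambda,\eta,z)$ the closed loop has a solution on $[0,\infty)$; every solution on $[0,\infty)$ is bounded and satisfies $\lim_{t\to\infty}y_i(t)=y_i^*$ for $i=1,\dots,N$, whatever the amplitudes and phases of the observation disturbances. (b) For every $c\in\mathbb R$ the closed loop has exactly one equilibrium with $\sum_i\tilde z_i=c$ (the sum $\sum_i z_i$ is constant along solutions), and $\tilde x_i=x_i^*$ at every equilibrium. Suppose in addition that each agent $i$ is $y_i^*$-observable: under a constant input $u$, the only solution of $\dot x=g_i(x,u)$ on $[0,\infty)$ with $h_i(x(t))=y_i^*$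 for all $t\ge0$ is $x\equiv x_i^*$, if there is any. Then the closed loop is asymptotically stable at its equilibrium: the steady-state motion of every equilibrium $(\tilde x,\tilde\lambda,\tilde z)$ is Lyapunov stable on $[0,\infty)$, and it attracts all solutions that start sufficiently close to it with $\sum_i z_i(0)=\sum_i\tilde z_i$. -/

import Mathlib

open Set Filter Topology
open scoped ContDiff NNReal

noncomputable section

/-- A weighted undirected graph on the nodes `0, …, N - 1`. -/
structure WeightedGraph (N : ℕ) where
  /-- The weighted adjacency matrix `(a i j)`. -/
  weight : Matrix (Fin N) (Fin N) ℝ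
  nonneg : ∀ i j, 0 ≤ weight i j
  symm : ∀ i j, weight i j = weight j i
  diag : ∀ i, weight i i = 0

/-- The underlying simple graph: `i` and `j` are joined by an edge iff `a i j > 0`. -/
def WeightedGraph.toSimpleGraph {N : ℕ} (G : WeightedGraph N) : SimpleGraph (Fin N) where
  Adj i j := 0 < G.weight i j
  symm := ⟨fun i j h => by rw [G.symm j i]; exact h⟩
  loopless := ⟨fun i h => by rw [G.diag i] at h; exact lt_irrefl _ h⟩

/-- `v ↦ (∑ j, a i j * (v i - v j))ᵢ`, the action of the graph Laplacian on a vector. -/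
def WeightedGraph.lap {N : ℕ} (G : WeightedGraph N) (v : Fin N → ℝ) (i : Fin N) : ℝ :=
  ∑ j, G.weight i j * (v i - v j)

/-- The data of one agent: a smooth single-input single-output plant `x' = g (x, u)`, `y = h x`,
a local cost `f`, a local resource datum `d0`, and a sinusoidal observation disturbance
`∑ j, amp j * sin (freq j * t + phase j)` with distinct positive frequencies. -/
structure Agent where
  /-- The dimension of the state. -/
  n : ℕ
  g : EuclideanSpace ℝ (Fin n) → ℝ → EuclideanSpace ℝ (Fin n)
  h : EuclideanSpace ℝ (Fin n) → ℝ
  g_smooth : ContDiff ℝ ∞ (fun p : EuclideanSpace ℝ (Fin n) × ℝ => g p.1 p.2)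
  h_smooth : ContDiff ℝ ∞ h
  /-- The local cost function. -/
  f : ℝ → ℝ
  /-- The true value of the local resource datum. -/
  d0 : ℝ
  /-- The number of sinusoids in the disturbance. -/
  k : ℕ
  freq : Fin k → ℝ
  freq_pos : ∀ j, 0 < freq j
  freq_injective : Function.Injective freq
  amp : Fin k → ℝ
  phase : Fin k → ℝ

/-- Index set of the `2 k + 1` coordinates of the observer: one for the constant, and a pair
`(0, j), (1, j)` for the `j`-th sinusoid. -/
abbrev ObsIdx (k : ℕ) : Type := Unit ⊕ (Fin 2 × Fin k)

namespace Agent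

/-- The state space of the plant. -/
abbrev X (A : Agent) : Type := EuclideanSpace ℝ (Fin A.n)

/-- The polluted observation of `d0`. -/
def obs (A : Agent) (t : ℝ) : ℝ :=
  A.d0 + ∑ j, A.amp j * Real.sin (A.freq j * t + A.phase j)

/-- `S = diag (0, [0, ω₁; -ω₁, 0], …, [0, ωₖ; -ωₖ, 0])`. -/
def S (A : Agent) : Matrix (ObsIdx A.k) (ObsIdx A.k) ℝ :=
  Matrix.fromBlocks 0 0 0 (Matrix.blockDiagonal fun j => !![0, A.freq j; -A.freq j, 0])

/-- The row vector `D = [1, 1, 0, …, 1, 0]`. -/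
def D (A : Agent) : ObsIdx A.k → ℝ :=
  Sum.elim (fun _ => 1) (fun p => if p.1 = 0 then 1 else 0)

/-- The row vector `[0, 1, 0, …, 1, 0]`, which reads off the disturbance part of the observer
state; its entry at the constant coordinate is zero. -/
def Deps (A : Agent) : ObsIdx A.k → ℝ :=
  Sum.elim (fun _ => 0) (fun p => if p.1 = 0 then 1 else 0)

/-- The exosystem state `ξ`, which satisfies `ξ' = S ξ` and `obs = D ξ`. -/
def exo (A : Agent) (t : ℝ) : ObsIdx A.k → ℝ :=
  Sum.elim (fun _ => A.d0)
    (fun p => if p.1 = 0 then A.amp p.2 * Real.sin (A.freq p.2 * t + A.phase p.2)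
      else A.amp p.2 * Real.cos (A.freq p.2 * t + A.phase p.2))

/-- The matrix `S - L D` of the observer with gain (column) vector `L`. -/
def obsMatrix (A : Agent) (L : ObsIdx A.k → ℝ) : Matrix (ObsIdx A.k) (ObsIdx A.k) ℝ :=
  A.S - Matrix.vecMulVec L A.D

end Agent

/-- A real square matrix is Hurwitz if all its complex eigenvalues have negative real part. -/
def IsHurwitz {ι : Type} [Fintype ι] [DecidableEq ι] (B : Matrix ι ι ℝ) : Prop :=
  ∀ μ : ℂ, μ ∈ spectrum ℂ (B.map (algebraMap ℝ ℂ)) → μ.re < 0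

/-- Class `K∞`; only the values on `[0, ∞)` matter. -/
structure IsClassKInf (α : ℝ → ℝ) : Prop where
  continuousOn : ContinuousOn α (Ici 0)
  strictMonoOn : StrictMonoOn α (Ici 0)
  map_zero : α 0 = 0
  tendsto_atTop : Tendsto α atTop atTop

/-- `f` is twice continuously differentiable with `lo ≤ f'' ≤ hi` and `0 < lo` (so that `f` is
strongly convex). -/
structure IsStronglyConvexC2 (f : ℝ → ℝ) (lo hi : ℝ) : Prop where
  contDiff : ContDiff ℝ 2 f
  lo_pos : 0 < lo
  lo_le : ∀ s, lo ≤ deriv (deriv f) s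
  le_hi : ∀ s, deriv (deriv f) s ≤ hi

namespace Agent

/-- `xs` and `us` are smooth, solve the regulator equations `g (xs r, us r) = 0`, `h (xs r) = r`
for every constant output `r`, and are the unique solution of these equations. -/
structure IsRegulatorSolution (A : Agent) (xs : ℝ → A.X) (us : ℝ → ℝ) : Prop where
  smooth_x : ContDiff ℝ ∞ xs
  smooth_u : ContDiff ℝ ∞ us
  equilibrium : ∀ r, A.g (xs r) (us r) = 0
  output : ∀ r, A.h (xs r) = r
  unique : ∀ (r : ℝ) (x : A.X) (u : ℝ), A.g x u = 0 → A.h x = r → x = xs r ∧ u = us r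

/-- The plant is passive with respect to `(x₀, u₀)`, with output reference `h x₀`. -/
def IsPassiveAt (A : Agent) (x₀ : A.X) (u₀ : ℝ) : Prop :=
  ∃ (α₁ α₂ : ℝ → ℝ) (V : A.X → ℝ), IsClassKInf α₁ ∧ IsClassKInf α₂ ∧ ContDiff ℝ 1 V ∧
    (∀ x, α₁ ‖x - x₀‖ ≤ V x ∧ V x ≤ α₂ ‖x - x₀‖) ∧
    ∀ (x : A.X) (u : ℝ), fderiv ℝ V x (A.g x u) ≤ (A.h x - A.h x₀) * (u - u₀)

/-- Observability at the output value `h x₀`: under a constant input, no trajectory of the plant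
other than the constant one `x₀` has an output that is identically equal to `h x₀`. -/
def IsObservableAt (A : Agent) (x₀ : A.X) : Prop :=
  ∀ (c : ℝ) (x : ℝ → A.X), IsIntegralCurveOn x (fun _ ξ => A.g ξ c) (Ici 0) →
    (∀ t, 0 ≤ t → A.h (x t) = A.h x₀) → ∀ t, 0 ≤ t → x t = x₀

/-- The control input `-γ f'(y) + lam + us y`. -/
def ctrl (A : Agent) (us : ℝ → ℝ) (γ : ℝ) (x : A.X) (lam : ℝ) : ℝ :=
  -γ * deriv A.f (A.h x) + lam + us (A.h x)

end Agent

/-- `y` is an optimal solution of: minimize `∑ i, f i (y i)` subject to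
`∑ i, y i = ∑ i, d0 i`. -/
def IsOptimalAllocation {N : ℕ} (ag : Fin N → Agent) (y : Fin N → ℝ) : Prop :=
  ∑ i, y i = ∑ i, (ag i).d0 ∧
    ∀ y' : Fin N → ℝ, ∑ i, y' i = ∑ i, (ag i).d0 → ∑ i, (ag i).f (y i) ≤ ∑ i, (ag i).f (y' i)

/-- The closed-loop states `(x, lam, η, z)`. -/
abbrev LoopState {N : ℕ} (ag : Fin N → Agent) : Type :=
  (∀ i, (ag i).X) × (Fin N → ℝ) × (∀ i, ObsIdx (ag i).k → ℝ) × (Fin N → ℝ)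

/-- The (time-dependent) vector field of the closed loop of the agents and the controller:
`x' = g (x, u)`, `lam' = - Lap lam - Lap z + d(t) - y - Deps η`, `η' = (S - L D) η + L d(t)`,
`z' = Lap lam`. -/
def closedLoop {N : ℕ} (G : WeightedGraph N) (ag : Fin N → Agent) (us : Fin N → ℝ → ℝ) (γ : ℝ)
    (L : ∀ i, ObsIdx (ag i).k → ℝ) (t : ℝ) : LoopState ag → LoopState ag :=
  fun (x, lam, η, z) =>
    (fun i => (ag i).g (x i) ((ag i).ctrl (us i) γ (x i) (lam i)),
     fun i => -G.lap lam i - G.lap z i + (ag i).obs t - (ag i).h (x i) - (ag i).Deps ⬝ᵥ η i,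
     fun i => ((ag i).obsMatrix (L i)).mulVec (η i) + (ag i).obs t • L i,
     fun i => G.lap lam i)

/-- `(x, lam, z)` is an equilibrium point of the closed loop (where the observer has reached the
exosystem state, so that `d(t) - Deps η` is replaced by `d0`). -/
def IsLoopEquilibrium {N : ℕ} (G : WeightedGraph N) (ag : Fin N → Agent) (us : Fin N → ℝ → ℝ)
    (γ : ℝ) (x : ∀ i, (ag i).X) (lam z : Fin N → ℝ) : Prop :=
  ∀ i, (ag i).g (x i) ((ag i).ctrl (us i) γ (x i) (lam i)) = 0 ∧
    -G.lap lam i - G.lap z i + (ag i).d0 - (ag i).h (x i) = 0 ∧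
    G.lap lam i = 0

/-- The steady-state motion of the closed loop at `(x, lam, z)`: the observer state coincides with
the exosystem state, all other components are at rest. -/
def steadyMotion {N : ℕ} (ag : Fin N → Agent) (x : ∀ i, (ag i).X) (lam z : Fin N → ℝ) (t : ℝ) :
    LoopState ag :=
  (x, lam, fun i => (ag i).exo t, z)

/-- The motion `p` of the system `s' = F t s` is (Lyapunov) stable on `[0, ∞)`. -/
def IsStableMotion {E : Type} [NormedAddCommGroup E] [NormedSpace ℝ E] (F : ℝ → E → E)
    (p : ℝ → E) : Prop :=
  ∀ ε > 0, ∃ δ > 0, ∀ s : ℝ → E, IsIntegralCurveOn s F (Ici 0) →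
    dist (s 0) (p 0) < δ → ∀ t, 0 ≤ t → dist (s t) (p t) < ε

/-- The motion `p` attracts the solutions of `s' = F t s` that start in `K` and near `p 0`. -/
def IsAttractiveMotionOn {E : Type} [NormedAddCommGroup E] [NormedSpace ℝ E] (F : ℝ → E → E)
    (K : Set E) (p : ℝ → E) : Prop :=
  ∃ δ > 0, ∀ s : ℝ → E, IsIntegralCurveOn s F (Ici 0) → s 0 ∈ K →
    dist (s 0) (p 0) < δ → Tendsto (fun t => dist (s t) (p t)) atTop (𝓝 0)

/-- The states with `∑ i, z i = c`; the closed loop leaves this set invariant. -/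
def zLeaf {N : ℕ} (ag : Fin N → Agent) (c : ℝ) : Set (LoopState ag) :=
  {s | ∑ i, s.2.2.2 i = c}

end

/-! In coordinates relative to the exosystem motion, `e = η - ξ(t)`, the closed loop becomes
autonomous: `e' = (S - L D) e`, and the multiplier equation sees the true datum `d0` perturbed only
by `-Deps · e`. Amplitudes and phases disappear from the dynamics, and the steady-state motion of an
equilibrium becomes a rest point with `e = 0`.

The difficulty is that the plants are only passive and the integrators are not damped, so a
perturbation linear in `e` cannot be absorbed against the deviation of `z`, nor against the mean of
the multipliers. The storage function `loopLyapunov` avoids such products by moving the reference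
points with `e`. As `S - L D` is invertible, there are row vectors with `c (S - L D) = -Deps` and
`c' (S - L D) = c`. Put `a = lam - lam₀ - c · e` and `b = z - z₀ - Lap (c' · e)`. Then `a'` contains
no direct disturbance term and `b' = Lap a` exactly. In the derivative of the storage function the
products of `a` with the output error and of `a` with `Lap b` cancel. The remaining products with
`e` involve only the output error and the Dirichlet form of `a`, both of which are dissipated, so
Young's inequality and a large multiple of a quadratic Lyapunov function for `e` absorb them
(`exists_isLoopLyapunov`). The gain condition makes each plant contribute minus the square of its
output error (`Agent.mul_ctrl_sub_le`).

The storage function is proper, which gives global existence and boundedness. LaSalle's principle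
(`exists_limit_trajectory_of_lyapunov`) gives limit trajectories with zero dissipation, on which the
outputs are optimal, `e = 0` and the multipliers agree. This already proves output convergence. On
such a trajectory the multipliers move with a common velocity, and the velocities sum to zero by
feasibility of `ystar`, so the inputs are constant. Observability then fixes the plant states,
uniqueness in the regulator equations fixes the multipliers, and conservation of `∑ i, z i` fixes
the integrators (`IsLoopLyapunov.eq_equilibrium`).

Strong convexity identifies the optimum with the unique feasible point of equal marginal costs, and
the equilibrium equations force exactly this condition (`IsLoopEquilibrium.eq_regulator`). -/

/-! ### Flows with Lyapunov functions and LaSalle's principle -/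

section Dynamics

variable {E : Type*} [NormedAddCommGroup E] [NormedSpace ℝ E]

/-- A compactly supported `C¹` vector field is complete. -/
theorem exists_isIntegralCurve_of_hasCompactSupport [CompleteSpace E] {Φ : E → E}
    (hΦ : ContDiff ℝ 1 Φ) (hc : HasCompactSupport Φ) (x₀ : E) :
    ∃ s : ℝ → E, s 0 = x₀ ∧ IsIntegralCurve s (fun _ => Φ) := by
  obtain ⟨K, hK⟩ := hΦ.lipschitzWith_of_hasCompactSupport hc one_ne_zero
  obtain ⟨B, hB⟩ := hc.exists_bound_of_continuous hΦ.continuous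
  have hB0 : 0 ≤ B := (norm_nonneg _).trans (hB x₀)
  have key : ∃ γ : ℝ → E, γ 0 = x₀ ∧ IsMIntegralCurve (I := modelWithCornersSelf ℝ E) γ Φ := by
    rw [exists_isMIntegralCurve_iff_exists_isMIntegralCurveOn_Ioo
      (contMDiff_vectorSpace_iff_contDiff.2 hΦ)]
    intro a
    obtain ⟨T, hT, haT⟩ : ∃ T : ℝ, 0 < T ∧ a ≤ T := ⟨|a| + 1, by positivity, by
      linarith [le_abs_self a]⟩
    -- The field is globally Lipschitz and bounded by `B`, so a ball of radius `B * T` leaves room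
    -- for a solution on all of `[-T, T]`.
    have hpl : IsPicardLindelof (fun _ => Φ) (tmin := -T) (tmax := T)
        ⟨0, by constructor <;> linarith⟩ x₀ (B.toNNReal * T.toNNReal) 0 B.toNNReal K := by
      refine ⟨fun t _ => hK.lipschitzOnWith, fun x _ => continuousOn_const, fun t _ x _ => ?_, ?_⟩
      · exact (hB x).trans (Real.le_coe_toNNReal B)
      · simp [hT.le]
    obtain ⟨α, hα0, hα⟩ := hpl.exists_eq_forall_mem_Icc_hasDerivWithinAt₀
    refine ⟨α, hα0, fun t ht => ?_⟩
    have ht' : t ∈ Ioo (-T) T := ⟨by linarith [ht.1], by linarith [ht.2]⟩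
    have h1 : HasDerivAt α (Φ (α t)) t :=
      (hα t (Ioo_subset_Icc_self ht')).hasDerivAt (Icc_mem_nhds ht'.1 ht'.2)
    exact h1.hasFDerivAt.hasMFDerivAt.hasMFDerivWithinAt
  obtain ⟨γ, h0, hγ⟩ := key
  refine ⟨γ, h0, fun t => ?_⟩
  have h : HasFDerivAt γ (ContinuousLinearMap.smulRight (1 : ℝ →L[ℝ] ℝ) (Φ (γ t))) t :=
    hasMFDerivAt_iff_hasFDerivAt.1 (hγ t)
  simpa [ContinuousLinearMap.smulRight_apply] using h.hasDerivAt

theorem IsIntegralCurveOn.hasDerivWithinAt_comp {Φ : E → E} {s : ℝ → E} {I : Set ℝ}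
    (hs : IsIntegralCurveOn s (fun _ => Φ) I) {U : E → ℝ} (hU : Differentiable ℝ U) {t : ℝ}
    (ht : t ∈ I) : HasDerivWithinAt (fun t => U (s t)) (fderiv ℝ U (s t) (Φ (s t))) I t :=
  (hU (s t)).hasFDerivAt.comp_hasDerivWithinAt t (hs t ht)

theorem IsIntegralCurveOn.antitoneOn_comp {Φ : E → E} {s : ℝ → E}
    (hs : IsIntegralCurveOn s (fun _ => Φ) (Ici 0)) {U : E → ℝ} (hU : Differentiable ℝ U)
    (hdec : ∀ x, fderiv ℝ U x (Φ x) ≤ 0) : AntitoneOn (fun t => U (s t)) (Ici 0) := by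
  have hd : ∀ t ∈ interior (Ici (0 : ℝ)),
      HasDerivAt (fun t => U (s t)) (fderiv ℝ U (s t) (Φ (s t))) t := fun t ht =>
    (hs.hasDerivWithinAt_comp hU (interior_subset ht)).hasDerivAt (mem_interior_iff_mem_nhds.1 ht)
  refine antitoneOn_of_deriv_nonpos (convex_Ici 0)
    (fun t ht => (hs.hasDerivWithinAt_comp hU ht).continuousWithinAt)
    (fun t ht => (hd t ht).differentiableAt.differentiableWithinAt) fun t ht => ?_
  rw [(hd t ht).deriv]
  exact hdec _

theorem eq_of_hasDerivWithinAt_Ici_zero {f : ℝ → E}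
    (hf : ∀ t, 0 ≤ t → HasDerivWithinAt f 0 (Ici 0) t) {t : ℝ} (ht : 0 ≤ t) : f t = f 0 :=
  constant_of_has_deriv_right_zero (a := 0) (b := t)
    (fun x hx => (hf x hx.1).continuousWithinAt.mono Icc_subset_Ici_self)
    (fun x hx => (hf x hx.1).mono (Ici_subset_Ici.2 hx.1)) t (right_mem_Icc.2 ht)

/-- A `C¹` vector field with a proper Lyapunov function is forward complete. -/
theorem exists_isIntegralCurveOn_Ici_of_lyapunov [FiniteDimensional ℝ E] {Φ : E → E}
    (hΦ : ContDiff ℝ 1 Φ) {U : E → ℝ} (hU : Differentiable ℝ U)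
    (hdec : ∀ x, fderiv ℝ U x (Φ x) ≤ 0) (hprop : ∀ c, Bornology.IsBounded {x | U x ≤ c})
    (x₀ : E) : ∃ s : ℝ → E, s 0 = x₀ ∧ IsIntegralCurveOn s (fun _ => Φ) (Ici 0) := by
  have := FiniteDimensional.complete ℝ E
  obtain ⟨r, hr0, hr⟩ := (hprop (U x₀)).subset_closedBall_lt 0 (0 : E)
  -- The cut-off is nonnegative, so `U` still decreases along the truncated field. Its trajectory
  -- therefore stays in the initial sublevel set, where the cut-off equals one and the two fields
  -- agree.
  let χ : ContDiffBump (0 : E) := ⟨r, r + 1, hr0, by linarith⟩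
  obtain ⟨s, hs0, hs⟩ := exists_isIntegralCurve_of_hasCompactSupport
    (Φ := fun x => χ x • Φ x) (χ.contDiff.smul hΦ) χ.hasCompactSupport.smul_right x₀
  refine ⟨s, hs0, fun t ht => ?_⟩
  have hle : U (s t) ≤ U x₀ := by
    rw [← hs0]
    refine (hs.isIntegralCurveOn (Ici 0)).antitoneOn_comp hU (fun x => ?_) self_mem_Ici ht ht
    rw [map_smul, smul_eq_mul]
    exact mul_nonpos_of_nonneg_of_nonpos χ.nonneg (hdec x)
  have h1 : HasDerivWithinAt s (χ (s t) • Φ (s t)) (Ici 0) t := (hs t).hasDerivWithinAt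
  rwa [χ.one_of_mem_closedBall (hr hle), one_smul] at h1

theorem IsIntegralCurveOn.comp_add_of_nonneg {Φ : E → E} {s : ℝ → E}
    (hs : IsIntegralCurveOn s (fun _ => Φ) (Ici 0)) {a : ℝ} (ha : 0 ≤ a) :
    IsIntegralCurveOn (fun t => s (t + a)) (fun _ => Φ) (Ici 0) := by
  intro t ht
  have h1 := hs (t + a) (add_nonneg ht ha)
  have h2 : HasDerivWithinAt (fun t : ℝ => t + a) 1 (Ici 0) t :=
    ((hasDerivAt_id t).add_const a).hasDerivWithinAt
  have h3 := h1.scomp t h2 (fun x hx => add_nonneg hx ha)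
  rw [one_smul] at h3
  exact h3

/-- **LaSalle's invariance principle.** Along every ultrafilter at infinity a trajectory converges
to the start of a trajectory on which the dissipation rate `R` vanishes. -/
theorem exists_limit_trajectory_of_lyapunov [FiniteDimensional ℝ E] {Φ : E → E}
    (hΦ : ContDiff ℝ 1 Φ) {U R : E → ℝ} (hU : Differentiable ℝ U) (hU0 : ∀ x, 0 ≤ U x)
    (hR0 : ∀ x, 0 ≤ R x) (hdec : ∀ x, fderiv ℝ U x (Φ x) ≤ -R x)
    (hprop : ∀ c, Bornology.IsBounded {x | U x ≤ c}) {s : ℝ → E}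
    (hs : IsIntegralCurveOn s (fun _ => Φ) (Ici 0)) (F : Ultrafilter ℝ)
    (hF : (F : Filter ℝ) ≤ atTop) :
    ∃ φ : ℝ → E, Tendsto s F (𝓝 (φ 0)) ∧ IsIntegralCurveOn φ (fun _ => Φ) (Ici 0) ∧
      ∀ t, 0 ≤ t → R (φ t) = 0 := by
  have := FiniteDimensional.proper_real E
  have hdec0 : ∀ x, fderiv ℝ U x (Φ x) ≤ 0 := fun x => (hdec x).trans (by linarith [hR0 x])
  have hanti := hs.antitoneOn_comp hU hdec0
  have hUcont : Continuous U := hU.continuous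
  have hFpos : ∀ a : ℝ, ∀ᶠ t in (F : Filter ℝ), a ≤ t := fun a => hF (eventually_ge_atTop a)
  have hcpt : IsCompact {x | U x ≤ U (s 0)} :=
    Metric.isCompact_of_isClosed_isBounded (isClosed_le hUcont continuous_const) (hprop _)
  obtain ⟨p, hpU, hp⟩ := hcpt.ultrafilter_le_nhds (F.map s) (by
    rw [le_principal_iff]
    exact (hFpos 0).mono fun t ht => hanti self_mem_Ici ht ht)
  have hp : Tendsto s F (𝓝 p) := hp
  obtain ⟨φ, rfl, hφ⟩ := exists_isIntegralCurveOn_Ici_of_lyapunov hΦ hU hdec0 hprop p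
  refine ⟨φ, hp, hφ, ?_⟩
  have hφU : ∀ t, 0 ≤ t → U (φ t) ≤ U (s 0) := fun t ht =>
    (hφ.antitoneOn_comp hU hdec0 self_mem_Ici ht ht).trans hpU
  -- Both `s` and `φ` stay in this compact sublevel set, so Grönwall's estimate with its Lipschitz
  -- constant carries the convergence at time zero to every later time.
  obtain ⟨K, hK⟩ := hΦ.locallyLipschitz.locallyLipschitzOn.exists_lipschitzOnWith_of_compact hcpt
  have hshift : ∀ τ, 0 ≤ τ → Tendsto (fun t => s (t + τ)) F (𝓝 (φ τ)) := by
    intro τ hτ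
    rw [tendsto_iff_dist_tendsto_zero] at hp ⊢
    have hb : ∀ᶠ t in (F : Filter ℝ), dist (s (t + τ)) (φ τ) ≤ dist (s t) (φ 0) *
        Real.exp (K * (τ - 0)) := by
      filter_upwards [hFpos 0] with t ht
      have hst := hs.comp_add_of_nonneg ht
      have := dist_le_of_trajectories_ODE_of_mem (v := fun _ => Φ)
        (s := fun _ => {x | U x ≤ U (s 0)})
        (K := K) (f := fun r => s (r + t)) (g := φ) (a := 0) (b := τ) (δ := dist (s t) (φ 0))
        (fun _ _ => hK) (hst.continuousOn.mono Icc_subset_Ici_self)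
        (fun r hr => (hst r hr.1).mono (Ici_subset_Ici.2 hr.1))
        (fun r hr => hanti self_mem_Ici (add_nonneg hr.1 ht) (add_nonneg hr.1 ht))
        (hφ.continuousOn.mono Icc_subset_Ici_self)
        (fun r hr => (hφ r hr.1).mono (Ici_subset_Ici.2 hr.1))
        (fun r hr => hφU r hr.1) (by simp) τ (right_mem_Icc.2 hτ)
      rwa [add_comm t τ]
    refine squeeze_zero' (Eventually.of_forall fun _ => dist_nonneg) hb ?_
    simpa using hp.mul_const (Real.exp (K * (τ - 0)))
  have hlim : ∃ ℓ, Tendsto (fun t => U (s t)) atTop (𝓝 ℓ) := by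
    have hmono : Antitone (fun t : ℝ => U (s (max t 0))) := fun a b hab =>
      hanti (mem_Ici.2 (le_max_right _ _)) (mem_Ici.2 (le_max_right _ _)) (max_le_max_right 0 hab)
    refine ⟨_, (tendsto_atTop_ciInf hmono ⟨0, ?_⟩).congr' ?_⟩
    · rintro _ ⟨t, rfl⟩
      exact hU0 _
    · filter_upwards [eventually_ge_atTop 0] with t ht
      rw [max_eq_left ht]
  obtain ⟨ℓ, hℓ⟩ := hlim
  -- `φ τ` is a limit of shifted points of `s`, and `U` has a single limit along `s`. Hence `U` is
  -- constant on `φ` and no dissipation can take place there.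
  have hconst : ∀ τ, 0 ≤ τ → U (φ τ) = ℓ := by
    intro τ hτ
    have h1 := (hUcont.tendsto (φ τ)).comp (hshift τ hτ)
    have h2 := (hℓ.comp (tendsto_atTop_add_const_right atTop τ tendsto_id)).mono_left hF
    exact tendsto_nhds_unique h1 h2
  intro t ht
  have h1 := hφ.hasDerivWithinAt_comp hU ht
  have h2 : HasDerivWithinAt (fun t => U (φ t)) 0 (Ici 0) t :=
    (hasDerivWithinAt_const t (Ici 0) ℓ).congr (fun x hx => hconst x hx) (hconst t ht)
  have h3 := (uniqueDiffOn_Ici (0 : ℝ) t ht).eq_deriv _ h1 h2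
  linarith [hdec (φ t), hR0 (φ t)]

/-- Sublevel sets of a proper positive definite function shrink to its zero. -/
theorem exists_sublevel_subset_ball [FiniteDimensional ℝ E] {U : E → ℝ} (hU : Continuous U)
    {p : E} (hpos : ∀ x, x ≠ p → 0 < U x) (hprop : ∀ c, Bornology.IsBounded {x | U x ≤ c})
    {ε : ℝ} (hε : 0 < ε) : ∃ m > 0, ∀ x, U x < m → dist x p < ε := by
  have := FiniteDimensional.proper_real E
  have hcpt : IsCompact ({x | U x ≤ 1} ∩ {x | ε ≤ dist x p}) :=
    Metric.isCompact_of_isClosed_isBounded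
      ((isClosed_le hU continuous_const).inter (isClosed_le continuous_const (by fun_prop)))
      ((hprop 1).subset inter_subset_left)
  rcases ({x | U x ≤ 1} ∩ {x | ε ≤ dist x p}).eq_empty_or_nonempty with he | hne
  · refine ⟨1, one_pos, fun x hx => ?_⟩
    by_contra! h
    exact (he ▸ (⟨hx.le, h⟩ : x ∈ {x | U x ≤ 1} ∩ {x | ε ≤ dist x p}) : x ∈ (∅ : Set E))
  · obtain ⟨q, hq, hmin⟩ := hcpt.exists_isMinOn hne hU.continuousOn
    have hqp : q ≠ p := by
      rintro rfl
      have : ε ≤ dist q q := hq.2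
      rw [dist_self] at this
      linarith
    refine ⟨min 1 (U q), lt_min one_pos (hpos q hqp), fun x hx => ?_⟩
    by_contra! h
    have := hmin (⟨(hx.trans_le (min_le_left _ _)).le, h⟩ :
      x ∈ {x | U x ≤ 1} ∩ {x | ε ≤ dist x p})
    exact absurd (hx.trans_le (min_le_right _ _)) (not_lt.2 this)

end Dynamics

/-! ### Quadratic Lyapunov functions of Hurwitz matrices -/

section Hurwitz

open Matrix

variable {ι : Type} [Fintype ι]

theorem Matrix.mulVec_dotProduct_self_le (A : Matrix ι ι ℝ) (v : ι → ℝ) :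
    A *ᵥ v ⬝ᵥ A *ᵥ v ≤ (∑ i, ∑ j, A i j ^ 2) * (v ⬝ᵥ v) := by
  rw [Finset.sum_mul]
  refine Finset.sum_le_sum fun i _ => ?_
  have := Finset.sum_mul_sq_le_sq_mul_sq Finset.univ (A i) v
  simp only [dotProduct, Matrix.mulVec, ← sq] at this ⊢
  exact this

variable [DecidableEq ι]

attribute [local instance] Matrix.linftyOpNormedRing Matrix.linftyOpNormedAlgebra in
/-- The entries of the powers of a complex matrix with spectrum in the open unit disc tend to
zero. -/
theorem Matrix.tendsto_pow_apply_zero_of_spectrum [Nonempty ι] (C : Matrix ι ι ℂ)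
    (hC : ∀ z ∈ spectrum ℂ C, ‖z‖ < 1) (i j : ι) :
    Tendsto (fun n : ℕ => (C ^ n) i j) atTop (𝓝 0) := by
  have hρ : spectralRadius ℂ C < ((1 : ℝ≥0) : ENNReal) :=
    spectrum.spectralRadius_lt_of_forall_lt C fun z hz => by
      rw [← NNReal.coe_lt_coe]; simpa using hC z hz
  -- By Gelfand's formula the norms of the powers are eventually below `r ^ n`, for any `r` between
  -- the spectral radius and one.
  obtain ⟨r, hr, hr1⟩ := ENNReal.lt_iff_exists_nnreal_btwn.1 hρ
  have hr1' : r < 1 := by exact_mod_cast hr1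
  have hev := (spectrum.pow_nnnorm_pow_one_div_tendsto_nhds_spectralRadius C).eventually_lt_const hr
  have hle : ∀ᶠ n : ℕ in atTop, ‖(C ^ n) i j‖ ≤ (r : ℝ) ^ n := by
    filter_upwards [hev, eventually_gt_atTop 0] with n hn hn0
    have h1 : ‖(C ^ n) i j‖₊ ≤ ‖C ^ n‖₊ := by
      rw [Matrix.linfty_opNNNorm_def]
      refine (Finset.single_le_sum (f := fun j => ‖(C ^ n) i j‖₊) (fun _ _ => zero_le)
        (Finset.mem_univ j)).trans ?_
      exact Finset.le_sup (f := fun i => ∑ j, ‖(C ^ n) i j‖₊) (Finset.mem_univ i)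
    have h2 : ‖C ^ n‖₊ ≤ r ^ n := by
      have hn' : (n : ℝ) ≠ 0 := by exact_mod_cast hn0.ne'
      have h3 := ENNReal.rpow_le_rpow hn.le (Nat.cast_nonneg (α := ℝ) n)
      rw [← ENNReal.rpow_mul, one_div, inv_mul_cancel₀ hn', ENNReal.rpow_one,
        ENNReal.rpow_natCast] at h3
      exact_mod_cast h3
    exact_mod_cast h1.trans h2
  exact squeeze_zero_norm' hle (tendsto_pow_atTop_nhds_zero_of_lt_one r.2 (by exact_mod_cast hr1'))

/-- For small `h > 0` the Euler step `1 + h B` of a Hurwitz matrix has its spectrum in the open unit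
disc. -/
theorem IsHurwitz.exists_norm_one_add_mul_lt_one {B : Matrix ι ι ℝ} (hB : IsHurwitz B) :
    ∃ h : ℝ, 0 < h ∧ ∀ μ ∈ spectrum ℂ (B.map (algebraMap ℝ ℂ)), ‖1 + (h : ℂ) * μ‖ < 1 := by
  have hev : ∀ᶠ h : ℝ in 𝓝[>] 0, ∀ μ ∈ spectrum ℂ (B.map (algebraMap ℝ ℂ)),
      ‖1 + (h : ℂ) * μ‖ < 1 := by
    rw [eventually_all_finite (Matrix.finite_spectrum _)]
    intro μ hμ
    have hre := hB μ hμ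
    -- This function is `(‖1 + h μ‖² - 1) / h`.
    have hlim : Tendsto (fun h : ℝ => 2 * μ.re + h * (μ.re ^ 2 + μ.im ^ 2)) (𝓝[>] 0)
        (𝓝 (2 * μ.re + 0 * (μ.re ^ 2 + μ.im ^ 2))) :=
      (Continuous.tendsto (by fun_prop) 0).mono_left nhdsWithin_le_nhds
    filter_upwards [hlim.eventually_lt_const 
      (show 2 * μ.re + 0 * (μ.re ^ 2 + μ.im ^ 2) < 0 by linarith), self_mem_nhdsWithin]
      with h hh hpos
    have hpos : 0 < h := hpos
    have hsq : ‖1 + (h : ℂ) * μ‖ ^ 2 < 1 := by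
      rw [← Complex.normSq_eq_norm_sq, Complex.normSq_apply]
      simp only [Complex.add_re, Complex.one_re, Complex.mul_re, Complex.ofReal_re,
        Complex.ofReal_im, Complex.add_im, Complex.one_im, Complex.mul_im]
      nlinarith
    exact (sq_lt_one_iff₀ (norm_nonneg _)).1 hsq
  obtain ⟨h, hh, hpos⟩ := (hev.and self_mem_nhdsWithin).exists
  exact ⟨h, hpos, hh⟩

/-- A Hurwitz matrix has a quadratic Lyapunov function. -/
theorem IsHurwitz.exists_lyapunov [Nonempty ι] {B : Matrix ι ι ℝ} (hB : IsHurwitz B) :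
    ∃ Q : Matrix ι ι ℝ, (∀ v, v ⬝ᵥ v ≤ v ⬝ᵥ Q *ᵥ v) ∧
      ∀ v, v ⬝ᵥ Q *ᵥ (B *ᵥ v) + B *ᵥ v ⬝ᵥ Q *ᵥ v ≤ -(v ⬝ᵥ v) := by
  obtain ⟨h, hpos, hh⟩ := hB.exists_norm_one_add_mul_lt_one
  set C : Matrix ι ι ℝ := 1 + h • B with hCdef
  have hCmap : C.map (algebraMap ℝ ℂ) =
      Polynomial.aeval (B.map (algebraMap ℝ ℂ)) (1 + Polynomial.C (h : ℂ) * Polynomial.X) := by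
    simp only [map_add, map_one, map_mul, Polynomial.aeval_C, Polynomial.aeval_X, hCdef]
    rw [← Algebra.smul_def]
    ext i j
    by_cases hij : i = j <;> simp [hij]
  have hspec : ∀ z ∈ spectrum ℂ (C.map (algebraMap ℝ ℂ)), ‖z‖ < 1 := by
    intro z hz
    rw [hCmap, spectrum.map_polynomial_aeval_of_nonempty _ _
      (spectrum.nonempty_of_isAlgClosed_of_finiteDimensional ℂ _)] at hz
    obtain ⟨μ, hμ, rfl⟩ := hz
    simpa using hh μ hμ
  have hentry : ∀ i j, Tendsto (fun n : ℕ => (C ^ n) i j) atTop (𝓝 0) := by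
    intro i j
    have h1 := Matrix.tendsto_pow_apply_zero_of_spectrum _ hspec i j
    rw [tendsto_zero_iff_norm_tendsto_zero] at h1 ⊢
    refine h1.congr fun n => ?_
    rw [← Matrix.map_pow C (algebraMap ℝ ℂ) n]
    simp
  have hfrob : Tendsto (fun n : ℕ => ∑ i, ∑ j, (C ^ n) i j ^ 2) atTop (𝓝 0) := by
    have := tendsto_finsetSum (Finset.univ : Finset ι) fun i _ =>
      tendsto_finsetSum (Finset.univ : Finset ι) fun j _ => (hentry i j).pow 2
    simpa using this
  -- A finite sum of `m` terms suffices once `C ^ m` is a contraction, so the usual infinite series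
  -- is not needed. Positivity of `m` keeps the term `n = 0`, which bounds the form below by `v ⬝ᵥ
  -- v`.
  obtain ⟨m, hm, hm0⟩ := ((hfrob.eventually_lt_const (show (0 : ℝ) < 1 / 2 by norm_num)).and
    (eventually_gt_atTop 0)).exists
  have hself : ∀ v : ι → ℝ, 0 ≤ v ⬝ᵥ v := fun v => Finset.sum_nonneg fun i _ => mul_self_nonneg _
  set Q₀ : Matrix ι ι ℝ := ∑ n ∈ Finset.range m, (C ^ n)ᵀ * C ^ n with hQ₀
  have hQform : ∀ v w, v ⬝ᵥ Q₀ *ᵥ w = ∑ n ∈ Finset.range m, (C ^ n) *ᵥ v ⬝ᵥ (C ^ n) *ᵥ w := by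
    intro v w
    rw [hQ₀, Matrix.sum_mulVec, dotProduct_sum]
    refine Finset.sum_congr rfl fun n _ => ?_
    rw [← Matrix.mulVec_mulVec, Matrix.dotProduct_mulVec, Matrix.vecMul_transpose]
  have hQ0 : ∀ v, v ⬝ᵥ v ≤ v ⬝ᵥ Q₀ *ᵥ v := by
    intro v
    rw [hQform]
    have := Finset.single_le_sum (f := fun n => (C ^ n) *ᵥ v ⬝ᵥ (C ^ n) *ᵥ v)
      (fun n _ => hself _) (Finset.mem_range.2 hm0)
    simpa using this
  -- Replacing `v` by `C *ᵥ v` shifts the sum by one index: the term `n = 0` is exchanged for the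
  -- term `n = m`, which is at most half as large.
  have hstep : ∀ v, (C *ᵥ v) ⬝ᵥ Q₀ *ᵥ (C *ᵥ v) ≤ v ⬝ᵥ Q₀ *ᵥ v - 1 / 2 * (v ⬝ᵥ v) := by
    intro v
    rw [hQform, hQform]
    have h1 : ∀ n, (C ^ n) *ᵥ (C *ᵥ v) = (C ^ (n + 1)) *ᵥ v := fun n => by
      rw [Matrix.mulVec_mulVec, pow_succ]
    simp only [h1]
    have h2 := Finset.sum_range_succ' (fun n => (C ^ n) *ᵥ v ⬝ᵥ (C ^ n) *ᵥ v) m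
    rw [Finset.sum_range_succ] at h2
    simp only [pow_zero, Matrix.one_mulVec] at h2
    have h3 := Matrix.mulVec_dotProduct_self_le (C ^ m) v
    nlinarith [hself v]
  have hcv : ∀ v, C *ᵥ v = v + h • B *ᵥ v := fun v => by
    rw [hCdef, Matrix.add_mulVec, Matrix.one_mulVec, Matrix.smul_mulVec]
  -- Expanding the discrete decrease at `C = 1 + h B`, the term quadratic in `h` is nonnegative and
  -- can be dropped.
  have hmain : ∀ v, 2 * h * (v ⬝ᵥ Q₀ *ᵥ (B *ᵥ v) + B *ᵥ v ⬝ᵥ Q₀ *ᵥ v) ≤ -(v ⬝ᵥ v) := by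
    intro v
    have h1 := hstep v
    rw [hcv] at h1
    simp only [Matrix.mulVec_add, Matrix.mulVec_smul, add_dotProduct, dotProduct_add,
      smul_dotProduct, dotProduct_smul, smul_eq_mul] at h1
    have h2 := (hself (B *ᵥ v)).trans (hQ0 (B *ᵥ v))
    nlinarith [mul_nonneg (mul_nonneg hpos.le hpos.le) h2]
  -- The factor exceeds `2 * h`, which normalizes the decay, and exceeds `1`, which preserves the
  -- lower bound.
  refine ⟨(1 + 2 * h) • Q₀, fun v => ?_, fun v => ?_⟩
  · rw [Matrix.smul_mulVec, dotProduct_smul, smul_eq_mul]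
    nlinarith [hQ0 v, hself v]
  · simp only [Matrix.smul_mulVec, dotProduct_smul, smul_eq_mul]
    have h1 := hmain v
    have h2 : v ⬝ᵥ Q₀ *ᵥ (B *ᵥ v) + B *ᵥ v ⬝ᵥ Q₀ *ᵥ v ≤ 0 := by
      by_contra! h3
      nlinarith [hself v, mul_pos hpos h3]
    nlinarith

theorem IsHurwitz.isUnit {B : Matrix ι ι ℝ} (hB : IsHurwitz B) : IsUnit B := by
  have h0 : (0 : ℂ) ∉ spectrum ℂ (B.map (algebraMap ℝ ℂ)) := fun h => by simpa using hB 0 h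
  rw [spectrum.zero_notMem_iff, Matrix.isUnit_iff_isUnit_det] at h0
  have h1 : (B.map (algebraMap ℝ ℂ)).det = algebraMap ℝ ℂ B.det :=
    (RingHom.map_det (algebraMap ℝ ℂ) B).symm
  rw [h1] at h0
  rw [Matrix.isUnit_iff_isUnit_det, isUnit_iff_ne_zero]
  rintro h2
  simp [h2] at h0

/-- A Hurwitz matrix acts surjectively on row vectors. -/
theorem IsHurwitz.exists_dotProduct_mulVec_eq {B : Matrix ι ι ℝ} (hB : IsHurwitz B) (r : ι → ℝ) :
    ∃ c : ι → ℝ, ∀ v, c ⬝ᵥ B *ᵥ v = r ⬝ᵥ v := by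
  have hu := (Matrix.isUnit_iff_isUnit_det B).1 hB.isUnit
  refine ⟨r ᵥ* B⁻¹, fun v => ?_⟩
  rw [← Matrix.dotProduct_mulVec, Matrix.mulVec_mulVec, Matrix.nonsing_inv_mul _ hu,
    Matrix.one_mulVec]

end Hurwitz

/-! ### The graph Laplacian -/

namespace WeightedGraph

variable {N : ℕ} (G : WeightedGraph N)

theorem lap_add (v w : Fin N → ℝ) (i : Fin N) : G.lap (v + w) i = G.lap v i + G.lap w i := by
  simp only [lap, Pi.add_apply, ← Finset.sum_add_distrib]
  exact Finset.sum_congr rfl fun j _ => by ring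

theorem lap_smul (c : ℝ) (v : Fin N → ℝ) (i : Fin N) : G.lap (c • v) i = c * G.lap v i := by
  simp only [lap, Pi.smul_apply, smul_eq_mul, Finset.mul_sum]
  exact Finset.sum_congr rfl fun j _ => by ring

theorem lap_sub (v w : Fin N → ℝ) (i : Fin N) : G.lap (v - w) i = G.lap v i - G.lap w i := by
  simp only [lap, Pi.sub_apply, ← Finset.sum_sub_distrib]
  exact Finset.sum_congr rfl fun j _ => by ring

theorem lap_of_const {v : Fin N → ℝ} (hv : ∀ i j, v i = v j) (i : Fin N) : G.lap v i = 0 :=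
  Finset.sum_eq_zero fun j _ => by rw [hv i j, sub_self, mul_zero]

/-- The Laplacian as a Dirichlet form. -/
theorem two_mul_sum_mul_lap (v w : Fin N → ℝ) :
    2 * ∑ i, v i * G.lap w i = ∑ i, ∑ j, G.weight i j * ((v i - v j) * (w i - w j)) := by
  have h1 : ∑ i, v i * G.lap w i = ∑ i, ∑ j, G.weight i j * (v i * (w i - w j)) := by
    refine Finset.sum_congr rfl fun i _ => ?_
    rw [lap, Finset.mul_sum]
    exact Finset.sum_congr rfl fun j _ => by ring
  have h2 : ∑ i, v i * G.lap w i = ∑ i, ∑ j, G.weight i j * (v j * (w j - w i)) := by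
    rw [h1, Finset.sum_comm]
    exact Finset.sum_congr rfl fun i _ => Finset.sum_congr rfl fun j _ => by rw [G.symm]
  rw [two_mul]
  nth_rewrite 1 [h1]
  rw [h2, ← Finset.sum_add_distrib]
  refine Finset.sum_congr rfl fun i _ => ?_
  rw [← Finset.sum_add_distrib]
  exact Finset.sum_congr rfl fun j _ => by ring

theorem sum_mul_lap_comm (v w : Fin N → ℝ) : ∑ i, v i * G.lap w i = ∑ i, w i * G.lap v i := by
  have h1 := G.two_mul_sum_mul_lap v w
  have h2 := G.two_mul_sum_mul_lap w v
  have h3 : ∑ i, ∑ j, G.weight i j * ((v i - v j) * (w i - w j)) =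
      ∑ i, ∑ j, G.weight i j * ((w i - w j) * (v i - v j)) :=
    Finset.sum_congr rfl fun i _ => Finset.sum_congr rfl fun j _ => by ring
  linarith

theorem sum_lap (v : Fin N → ℝ) : ∑ i, G.lap v i = 0 := by
  have h := G.sum_mul_lap_comm (fun _ => 1) v
  simp only [one_mul] at h
  rw [h]
  exact Finset.sum_eq_zero fun i _ => by rw [G.lap_of_const (fun _ _ => rfl), mul_zero]

theorem sum_mul_lap_self_nonneg (v : Fin N → ℝ) : 0 ≤ ∑ i, v i * G.lap v i := by
  have h := G.two_mul_sum_mul_lap v v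
  have : 0 ≤ ∑ i, ∑ j, G.weight i j * ((v i - v j) * (v i - v j)) :=
    Finset.sum_nonneg fun i _ => Finset.sum_nonneg fun j _ =>
      mul_nonneg (G.nonneg i j) (mul_self_nonneg _)
  linarith

/-- Young's inequality for the Dirichlet form. -/
theorem neg_sum_mul_lap_le (v w : Fin N → ℝ) :
    -∑ i, v i * G.lap w i ≤ 1 / 2 * ∑ i, v i * G.lap v i + 1 / 2 * ∑ i, w i * G.lap w i := by
  have h := G.sum_mul_lap_self_nonneg (v + w)
  simp only [lap_add, Pi.add_apply, mul_add, add_mul, Finset.sum_add_distrib] at h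
  linarith [G.sum_mul_lap_comm v w]

variable {G}

/-- The Dirichlet form is a sum of nonnegative edge terms, so each of them vanishes; equality then
propagates along a walk. -/
theorem eq_of_sum_mul_lap_self_eq_zero (hG : G.toSimpleGraph.Connected) {v : Fin N → ℝ}
    (hv : ∑ i, v i * G.lap v i = 0) (i j : Fin N) : v i = v j := by
  have h0 : ∑ i, ∑ j, G.weight i j * ((v i - v j) * (v i - v j)) = 0 := by
    rw [← G.two_mul_sum_mul_lap, hv, mul_zero]
  have hterm : ∀ i j, 0 ≤ G.weight i j * ((v i - v j) * (v i - v j)) := fun i j =>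
    mul_nonneg (G.nonneg i j) (mul_self_nonneg _)
  have h1 : ∀ i j, G.weight i j * ((v i - v j) * (v i - v j)) = 0 := fun i j =>
    (Finset.sum_eq_zero_iff_of_nonneg fun j _ => hterm i j).1
      ((Finset.sum_eq_zero_iff_of_nonneg fun i _ => Finset.sum_nonneg fun j _ => hterm i j).1 h0 i
        (Finset.mem_univ i)) j (Finset.mem_univ j)
  obtain ⟨p⟩ := hG.preconnected i j
  induction p with
  | nil => rfl
  | @cons a b c hab _ ih =>
    have hab : 0 < G.weight a b := hab
    have h2 := (mul_eq_zero.1 (h1 a b)).resolve_left hab.ne'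
    rw [← ih]
    linarith [mul_self_eq_zero.1 h2]

theorem eq_of_lap_eq_zero (hG : G.toSimpleGraph.Connected) {v : Fin N → ℝ}
    (hv : ∀ i, G.lap v i = 0) (i j : Fin N) : v i = v j :=
  eq_of_sum_mul_lap_self_eq_zero hG (Finset.sum_eq_zero fun i _ => by rw [hv, mul_zero]) i j

/-- A vector in the kernel of the Laplacian with vanishing sum is zero. -/
theorem eq_zero_of_lap_eq_zero (hG : G.toSimpleGraph.Connected) {v : Fin N → ℝ}
    (hv : ∀ i, G.lap v i = 0) (hs : ∑ i, v i = 0) : v = 0 := by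
  funext i
  have h1 : ∑ j, v j = N * v i := by
    rw [Finset.sum_congr rfl fun j _ => eq_of_lap_eq_zero hG hv j i]
    simp
  have hN : (N : ℝ) ≠ 0 := by exact_mod_cast (Fin.pos i).ne'
  rw [hs] at h1
  exact (mul_eq_zero.1 h1.symm).resolve_left hN

/-- The range of the Laplacian of a connected graph consists of the vectors with vanishing sum, and
the preimage can be chosen with vanishing sum. -/
theorem exists_lap_eq (hG : G.toSimpleGraph.Connected) {w : Fin N → ℝ} (hw : ∑ i, w i = 0) :
    ∃ v : Fin N → ℝ, (∀ i, G.lap v i = w i) ∧ ∑ i, v i = 0 := by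
  have hN : (N : ℝ) ≠ 0 := by
    obtain ⟨i⟩ := hG.nonempty
    exact_mod_cast (Fin.pos i).ne'
  -- Adding the total sum to the Laplacian removes its kernel, the constants. The entries of `T v`
  -- sum to `N` times the sum of `v`, so on targets of zero sum the extra term vanishes.
  let T : (Fin N → ℝ) →ₗ[ℝ] (Fin N → ℝ) :=
    { toFun := fun v i => G.lap v i + ∑ j, v j
      map_add' := fun v w => by
        funext i
        simp only [lap_add, Pi.add_apply, Finset.sum_add_distrib]
        ring
      map_smul' := fun c v => by
        funext i
        simp only [lap_smul, Pi.smul_apply, smul_eq_mul, ← Finset.mul_sum, RingHom.id_apply]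
        ring }
  have hsum : ∀ v, ∑ i, T v i = N * ∑ j, v j := fun v => by
    simp [T, Finset.sum_add_distrib, sum_lap]
  have hzero : ∀ v, ∑ i, T v i = 0 → ∑ j, v j = 0 := fun v h => by
    rw [hsum] at h
    exact (mul_eq_zero.1 h).resolve_left hN
  have hinj : Function.Injective T := by
    rw [injective_iff_map_eq_zero]
    intro v hv
    have hs := hzero v (by simp [hv])
    refine eq_zero_of_lap_eq_zero hG (fun i => ?_) hs
    have := congrFun hv i
    simpa [T, hs] using this
  obtain ⟨v, rfl⟩ := LinearMap.surjective_of_injective hinj w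
  have hs := hzero v hw
  exact ⟨v, fun i => by simp [T, hs], hs⟩

end WeightedGraph

/-! ### Optimal allocations and equal marginal costs -/

section Allocation

theorem IsStronglyConvexC2.contDiff_deriv {f : ℝ → ℝ} {lo hi : ℝ}
    (hf : IsStronglyConvexC2 f lo hi) : ContDiff ℝ 1 (deriv f) :=
  ContDiff.deriv' (by rw [one_add_one_eq_two]; exact hf.contDiff)

theorem IsStronglyConvexC2.differentiable_deriv {f : ℝ → ℝ} {lo hi : ℝ}
    (hf : IsStronglyConvexC2 f lo hi) : Differentiable ℝ (deriv f) :=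
  hf.contDiff_deriv.differentiable one_ne_zero

theorem IsStronglyConvexC2.mul_sub_le {f : ℝ → ℝ} {lo hi : ℝ} (hf : IsStronglyConvexC2 f lo hi)
    {a b : ℝ} (hab : a ≤ b) : lo * (b - a) ≤ deriv f b - deriv f a :=
  mul_sub_le_image_sub_of_le_deriv hf.differentiable_deriv hf.lo_le hab

theorem IsStronglyConvexC2.mul_sq_le {f : ℝ → ℝ} {lo hi : ℝ} (hf : IsStronglyConvexC2 f lo hi)
    (a b : ℝ) : lo * (a - b) ^ 2 ≤ (a - b) * (deriv f a - deriv f b) := by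
  rcases le_total a b with h | h
  · nlinarith [hf.mul_sub_le h, mul_le_mul_of_nonneg_left (hf.mul_sub_le h) (sub_nonneg.2 h)]
  · nlinarith [hf.mul_sub_le h, mul_le_mul_of_nonneg_left (hf.mul_sub_le h) (sub_nonneg.2 h)]

theorem IsStronglyConvexC2.strictMono_deriv {f : ℝ → ℝ} {lo hi : ℝ}
    (hf : IsStronglyConvexC2 f lo hi) : StrictMono (deriv f) := fun a b hab => by
  nlinarith [hf.mul_sub_le hab.le, mul_pos hf.lo_pos (sub_pos.2 hab)]

theorem IsStronglyConvexC2.surjective_deriv {f : ℝ → ℝ} {lo hi : ℝ}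
    (hf : IsStronglyConvexC2 f lo hi) : Function.Surjective (deriv f) := by
  refine hf.differentiable_deriv.continuous.surjective ?_ ?_
  · refine tendsto_atTop_mono' _ ?_ (tendsto_atTop_add_const_right atTop (deriv f 0)
      (tendsto_id.const_mul_atTop hf.lo_pos))
    filter_upwards [eventually_ge_atTop 0] with x hx
    have := hf.mul_sub_le hx
    simp only [id]
    linarith
  · refine tendsto_atBot_mono' _ ?_ (tendsto_atBot_add_const_right atBot (deriv f 0)
      (tendsto_id.const_mul_atBot hf.lo_pos))
    filter_upwards [eventually_le_atBot 0] with x hx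
    have := hf.mul_sub_le hx
    simp only [id]
    linarith

/-- A strictly convex function lies strictly above its tangents. -/
theorem IsStronglyConvexC2.tangent_lt {f : ℝ → ℝ} {lo hi : ℝ} (hf : IsStronglyConvexC2 f lo hi)
    {a b : ℝ} (hab : b ≠ a) : f a + deriv f a * (b - a) < f b := by
  have hd : Differentiable ℝ f := hf.contDiff.differentiable two_ne_zero
  rcases lt_or_gt_of_ne hab with h | h
  · obtain ⟨c, hc, hc'⟩ := exists_deriv_eq_slope f h hd.continuous.continuousOn hd.differentiableOn
    rw [eq_div_iff (sub_pos.2 h).ne'] at hc'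
    nlinarith [hf.strictMono_deriv hc.2, mul_pos (sub_pos.2 (hf.strictMono_deriv hc.2))
      (sub_pos.2 h)]
  · obtain ⟨c, hc, hc'⟩ := exists_deriv_eq_slope f h hd.continuous.continuousOn hd.differentiableOn
    rw [eq_div_iff (sub_pos.2 h).ne'] at hc'
    nlinarith [hf.strictMono_deriv hc.1, mul_pos (sub_pos.2 (hf.strictMono_deriv hc.1))
      (sub_pos.2 h)]

variable {N : ℕ} {ag : Fin N → Agent} {hlo hhi : Fin N → ℝ}

/-- A feasible allocation with equal marginal costs is strictly better than any other. -/
theorem sum_cost_lt_of_kkt (hf : ∀ i, IsStronglyConvexC2 (ag i).f (hlo i) (hhi i))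
    {y y' : Fin N → ℝ} {μ : ℝ} (hy : ∑ i, y i = ∑ i, (ag i).d0)
    (hμ : ∀ i, deriv (ag i).f (y i) = μ) (hy' : ∑ i, y' i = ∑ i, (ag i).d0) (hne : y' ≠ y) :
    ∑ i, (ag i).f (y i) < ∑ i, (ag i).f (y' i) := by
  obtain ⟨k, hk⟩ := Function.ne_iff.1 hne
  have h1 : ∑ i, ((ag i).f (y i) + μ * (y' i - y i)) < ∑ i, (ag i).f (y' i) := by
    refine Finset.sum_lt_sum (fun i _ => ?_) ⟨k, Finset.mem_univ k, ?_⟩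
    · by_cases h : y' i = y i
      · simp [h]
      · rw [← hμ i]
        exact ((hf i).tangent_lt h).le
    · rw [← hμ k]
      exact (hf k).tangent_lt hk
  rwa [Finset.sum_add_distrib, ← Finset.mul_sum, Finset.sum_sub_distrib, hy, hy', sub_self,
    mul_zero, add_zero] at h1

theorem isOptimalAllocation_of_kkt (hf : ∀ i, IsStronglyConvexC2 (ag i).f (hlo i) (hhi i))
    {y : Fin N → ℝ} {μ : ℝ} (hy : ∑ i, y i = ∑ i, (ag i).d0)
    (hμ : ∀ i, deriv (ag i).f (y i) = μ) : IsOptimalAllocation ag y := by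
  refine ⟨hy, fun y' hy' => ?_⟩
  by_cases h : y' = y
  · rw [h]
  · exact (sum_cost_lt_of_kkt hf hy hμ hy' h).le

theorem IsOptimalAllocation.eq_of_kkt (hf : ∀ i, IsStronglyConvexC2 (ag i).f (hlo i) (hhi i))
    {y y' : Fin N → ℝ} {μ : ℝ} (hy : ∑ i, y i = ∑ i, (ag i).d0)
    (hμ : ∀ i, deriv (ag i).f (y i) = μ) (hy' : IsOptimalAllocation ag y') : y' = y := by
  by_contra h
  exact absurd (hy'.2 y hy) (not_le.2 (sum_cost_lt_of_kkt hf hy hμ hy'.1 h))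

/-- The marginal costs are increasing bijections of the line, so the total demand at price `μ` is
continuous in `μ`. The intermediate value theorem applies between the least and the greatest of the
marginal costs at the data `d0`. -/
theorem exists_kkt (hf : ∀ i, IsStronglyConvexC2 (ag i).f (hlo i) (hhi i)) :
    ∃ (y : Fin N → ℝ) (μ : ℝ), ∑ i, y i = ∑ i, (ag i).d0 ∧
      ∀ i, deriv (ag i).f (y i) = μ := by
  let e : ∀ i, ℝ ≃o ℝ := fun i =>
    (hf i).strictMono_deriv.orderIsoOfSurjective _ (hf i).surjective_deriv
  have hcont : Continuous fun μ : ℝ => ∑ i, (e i).symm μ :=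
    continuous_finsetSum _ fun i _ => (e i).symm.continuous
  obtain ⟨b, hb⟩ := (Set.finite_range fun i => e i (ag i).d0).bddAbove
  obtain ⟨a, ha⟩ := (Set.finite_range fun i => e i (ag i).d0).bddBelow
  obtain ⟨μ, hμ⟩ := mem_range_of_exists_le_of_exists_ge hcont
    ⟨a, Finset.sum_le_sum fun i _ => (e i).symm_apply_le.2 (ha ⟨i, rfl⟩)⟩
    ⟨b, Finset.sum_le_sum fun i _ => (e i).le_symm_apply.2 (hb ⟨i, rfl⟩)⟩
  exact ⟨fun i => (e i).symm μ, μ, hμ, fun i => (e i).apply_symm_apply μ⟩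

/-- At the optimal allocation the marginal costs agree. -/
theorem IsOptimalAllocation.exists_deriv_eq (hf : ∀ i, IsStronglyConvexC2 (ag i).f (hlo i) (hhi i))
    {y : Fin N → ℝ} (hy : IsOptimalAllocation ag y) : ∃ μ : ℝ, ∀ i, deriv (ag i).f (y i) = μ := by
  obtain ⟨y', μ, hy', hμ⟩ := exists_kkt hf
  exact ⟨μ, hy.eq_of_kkt hf hy' hμ ▸ hμ⟩

theorem existsUnique_isOptimalAllocation (hf : ∀ i, IsStronglyConvexC2 (ag i).f (hlo i) (hhi i)) :
    ∃! y : Fin N → ℝ, IsOptimalAllocation ag y := by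
  obtain ⟨y, μ, hy, hμ⟩ := exists_kkt hf
  exact ⟨y, isOptimalAllocation_of_kkt hf hy hμ, fun y' hy' => hy'.eq_of_kkt hf hy hμ⟩

end Allocation

/-! ### The exosystem and the regulator equations -/

namespace Agent

open Matrix

variable (A : Agent)

theorem hasDerivAt_exo (t : ℝ) : HasDerivAt A.exo (A.S *ᵥ A.exo t) t := by
  rw [hasDerivAt_pi]
  have harg : ∀ j, HasDerivAt (fun t : ℝ => A.freq j * t + A.phase j) (A.freq j) t := fun j => by
    simpa using ((hasDerivAt_id t).const_mul (A.freq j)).add_const (A.phase j)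
  rintro (u | ⟨a, j⟩)
  · have h0 : (A.S *ᵥ A.exo t) (Sum.inl u) = 0 := by
      simp [Agent.S, Matrix.mulVec, dotProduct]
    rw [h0]
    exact hasDerivAt_const t A.d0
  · obtain rfl | rfl : a = 0 ∨ a = 1 := by omega
    · have h0 : (A.S *ᵥ A.exo t) (Sum.inr (0, j)) =
          A.amp j * (Real.cos (A.freq j * t + A.phase j) * A.freq j) := by
        simp [Agent.S, Agent.exo, Matrix.mulVec, dotProduct, Fintype.sum_prod_type,
          Matrix.blockDiagonal_apply]
        ring
      rw [h0]
      exact (harg j).sin.const_mul (A.amp j)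
    · have h0 : (A.S *ᵥ A.exo t) (Sum.inr (1, j)) =
          A.amp j * (-Real.sin (A.freq j * t + A.phase j) * A.freq j) := by
        simp [Agent.S, Agent.exo, Matrix.mulVec, dotProduct, Fintype.sum_prod_type,
          Matrix.blockDiagonal_apply]
        ring
      rw [h0]
      exact (harg j).cos.const_mul (A.amp j)

theorem D_dotProduct_exo (t : ℝ) : A.D ⬝ᵥ A.exo t = A.obs t := by
  simp [Agent.D, Agent.exo, Agent.obs, dotProduct, Fintype.sum_prod_type]

theorem Deps_dotProduct_exo (t : ℝ) : A.Deps ⬝ᵥ A.exo t = A.obs t - A.d0 := by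
  simp [Agent.Deps, Agent.exo, Agent.obs, dotProduct, Fintype.sum_prod_type]

theorem obsMatrix_mulVec_exo (L : ObsIdx A.k → ℝ) (t : ℝ) :
    A.obsMatrix L *ᵥ A.exo t + A.obs t • L = A.S *ᵥ A.exo t := by
  rw [Agent.obsMatrix, Matrix.sub_mulVec, Matrix.vecMulVec_mulVec, D_dotProduct_exo]
  ext i
  simp [mul_comm]

theorem norm_exo_le (t : ℝ) : ‖A.exo t‖ ≤ |A.d0| + ∑ j, |A.amp j| := by
  have hs : ∀ j, |A.amp j| ≤ ∑ j, |A.amp j| := fun j =>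
    Finset.single_le_sum (f := fun j => |A.amp j|) (fun _ _ => abs_nonneg _) (Finset.mem_univ j)
  have h0 : 0 ≤ ∑ j, |A.amp j| := Finset.sum_nonneg fun _ _ => abs_nonneg _
  have hb : ∀ a b : ℝ, |b| ≤ 1 → |a * b| ≤ |a| := fun a b h => by
    rw [abs_mul]
    exact mul_le_of_le_one_right (abs_nonneg _) h
  rw [pi_norm_le_iff_of_nonneg (add_nonneg (abs_nonneg _) h0)]
  rintro (u | ⟨a, j⟩)
  · simpa [Agent.exo] using h0
  · refine le_trans ?_ ((hs j).trans (le_add_of_nonneg_left (abs_nonneg A.d0)))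
    simp only [Agent.exo, Sum.elim_inr, Real.norm_eq_abs]
    split_ifs
    · exact hb _ _ (Real.abs_sin_le_one _)
    · exact hb _ _ (Real.abs_cos_le_one _)

theorem IsRegulatorSolution.eq_of_equilibrium {A : Agent} {xs : ℝ → A.X} {us : ℝ → ℝ}
    (hreg : A.IsRegulatorSolution xs us) {γ : ℝ} {x : A.X} {lam : ℝ}
    (h : A.g x (A.ctrl us γ x lam) = 0) :
    x = xs (A.h x) ∧ lam = γ * deriv A.f (A.h x) := by
  obtain ⟨h1, h2⟩ := hreg.unique _ _ _ h rfl
  refine ⟨h1, ?_⟩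
  rw [Agent.ctrl] at h2
  linarith

end Agent

/-! ### The autonomous closed loop in observer error coordinates -/

section ObserverError

variable {N : ℕ} (G : WeightedGraph N) (ag : Fin N → Agent) (us : Fin N → ℝ → ℝ) (γ : ℝ)
  (L : ∀ i, ObsIdx (ag i).k → ℝ)

/-- The closed loop in the autonomous coordinates `(x, lam, η - ξ(t), z)`. -/
noncomputable def observerErrorLoop : LoopState ag → LoopState ag :=
  fun s =>
    (fun i => (ag i).g (s.1 i) ((ag i).ctrl (us i) γ (s.1 i) (s.2.1 i)),
     fun i => -G.lap s.2.1 i - G.lap s.2.2.2 i + (ag i).d0 - (ag i).h (s.1 i)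
       - (ag i).Deps ⬝ᵥ s.2.2.1 i,
     fun i => ((ag i).obsMatrix (L i)).mulVec (s.2.2.1 i),
     fun i => G.lap s.2.1 i)

/-- The exosystem states, as a motion in the observer coordinates. -/
noncomputable def exoMotion (t : ℝ) : LoopState ag := (0, 0, fun i => (ag i).exo t, 0)

theorem hasDerivAt_exoMotion (t : ℝ) :
    HasDerivAt (exoMotion ag) (0, 0, fun i => ((ag i).S).mulVec ((ag i).exo t), 0) t :=
  (hasDerivAt_const t _).prodMk <| (hasDerivAt_const t _).prodMk <|
    (hasDerivAt_pi.2 fun i => (ag i).hasDerivAt_exo t).prodMk (hasDerivAt_const t _)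

/-- The exosystem motion itself solves the observer equation, and `Deps` reads off exactly the
disturbance `obs - d0`; all explicit time dependence therefore sits in the last summand, the
velocity of `exoMotion`. -/
theorem closedLoop_add_exoMotion (s : LoopState ag) (t : ℝ) :
    closedLoop G ag us γ L t (s + exoMotion ag t) =
      observerErrorLoop G ag us γ L s +
        (0, 0, fun i => ((ag i).S).mulVec ((ag i).exo t), 0) := by
  obtain ⟨x, lam, e, z⟩ := s
  simp only [exoMotion, closedLoop, observerErrorLoop, Prod.mk_add_mk, add_zero]
  refine Prod.ext rfl (Prod.ext ?_ (Prod.ext ?_ rfl))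
  · funext i
    simp only [Pi.add_apply, dotProduct_add, Agent.Deps_dotProduct_exo]
    ring
  · funext i
    simp only [Pi.add_apply, Matrix.mulVec_add]
    rw [← (ag i).obsMatrix_mulVec_exo (L i) t, add_assoc]

variable {G ag us γ L}

theorem IsIntegralCurveOn.sub_exoMotion {s : ℝ → LoopState ag}
    (hs : IsIntegralCurveOn s (closedLoop G ag us γ L) (Ici 0)) :
    IsIntegralCurveOn (fun t => s t - exoMotion ag t) (fun _ => observerErrorLoop G ag us γ L)
      (Ici 0) := by
  intro t ht
  have h := (hs t ht).sub (hasDerivAt_exoMotion ag t).hasDerivWithinAt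
  have h2 := closedLoop_add_exoMotion G ag us γ L (s t - exoMotion ag t) t
  rw [sub_add_cancel] at h2
  rw [h2, add_sub_cancel_right] at h
  exact h

theorem IsIntegralCurveOn.add_exoMotion {s : ℝ → LoopState ag}
    (hs : IsIntegralCurveOn s (fun _ => observerErrorLoop G ag us γ L) (Ici 0)) :
    IsIntegralCurveOn (fun t => s t + exoMotion ag t) (closedLoop G ag us γ L) (Ici 0) := by
  intro t ht
  have h := (hs t ht).add (hasDerivAt_exoMotion ag t).hasDerivWithinAt
  rw [← closedLoop_add_exoMotion] at h
  exact h

theorem isBounded_range_exoMotion : Bornology.IsBounded (range (exoMotion ag)) := by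
  refine isBounded_iff_forall_norm_le.2 ⟨∑ i, (|(ag i).d0| + ∑ j, |(ag i).amp j|), ?_⟩
  have h0 : ∀ i, 0 ≤ |(ag i).d0| + ∑ j, |(ag i).amp j| := fun i => by positivity
  have h1 : 0 ≤ ∑ i, (|(ag i).d0| + ∑ j, |(ag i).amp j|) := Finset.sum_nonneg fun i _ => h0 i
  rintro _ ⟨t, rfl⟩
  simp only [exoMotion, norm_prod_le_iff, norm_zero, h1, true_and, and_true]
  rw [pi_norm_le_iff_of_nonneg h1]
  exact fun i => ((ag i).norm_exo_le t).trans
    (Finset.single_le_sum (f := fun i => |(ag i).d0| + ∑ j, |(ag i).amp j|) (fun i _ => h0 i)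
      (Finset.mem_univ i))

theorem contDiff_plant {n : WithTop ℕ∞} (i : Fin N) :
    ContDiff ℝ n (fun s : LoopState ag => s.1 i) :=
  contDiff_pi.1 contDiff_fst i

theorem contDiff_multiplier {n : WithTop ℕ∞} (i : Fin N) :
    ContDiff ℝ n (fun s : LoopState ag => s.2.1 i) :=
  contDiff_pi.1 (contDiff_fst.comp contDiff_snd) i

theorem contDiff_observer {n : WithTop ℕ∞} (i : Fin N) :
    ContDiff ℝ n (fun s : LoopState ag => s.2.2.1 i) :=
  contDiff_pi.1 (contDiff_fst.comp (contDiff_snd.comp contDiff_snd)) i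

theorem contDiff_integrator {n : WithTop ℕ∞} (i : Fin N) :
    ContDiff ℝ n (fun s : LoopState ag => s.2.2.2 i) :=
  contDiff_pi.1 (contDiff_snd.comp (contDiff_snd.comp contDiff_snd)) i

theorem WeightedGraph.contDiff_lap (G : WeightedGraph N) {E : Type*} [NormedAddCommGroup E]
    [NormedSpace ℝ E] {n : WithTop ℕ∞} {v : E → Fin N → ℝ}
    (hv : ∀ i, ContDiff ℝ n (fun s => v s i)) (i : Fin N) :
    ContDiff ℝ n (fun s => G.lap (v s) i) :=
  ContDiff.sum fun j _ => contDiff_const.mul ((hv i).sub (hv j))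

theorem ContDiff.dotProduct_const_left {E ι : Type*} [Fintype ι] [NormedAddCommGroup E]
    [NormedSpace ℝ E] {n : WithTop ℕ∞} {v : E → ι → ℝ} (hv : ContDiff ℝ n v) (c : ι → ℝ) :
    ContDiff ℝ n (fun s => c ⬝ᵥ v s) :=
  ContDiff.sum fun j _ => contDiff_const.mul (contDiff_pi.1 hv j)

theorem ContDiff.const_mulVec {E ι : Type*} [Fintype ι] [NormedAddCommGroup E]
    [NormedSpace ℝ E] {n : WithTop ℕ∞} {v : E → ι → ℝ} (hv : ContDiff ℝ n v) (B : Matrix ι ι ℝ) :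
    ContDiff ℝ n (fun s => B.mulVec (v s)) :=
  contDiff_pi.2 fun i => hv.dotProduct_const_left (B i)

theorem contDiff_observerErrorLoop (hf : ∀ i, ContDiff ℝ 1 (deriv (ag i).f))
    (hus : ∀ i, ContDiff ℝ 1 (us i)) : ContDiff ℝ 1 (observerErrorLoop G ag us γ L) := by
  have hg : ∀ i, ContDiff ℝ 1 (fun p : (ag i).X × ℝ => (ag i).g p.1 p.2) := fun i =>
    (ag i).g_smooth.of_le (by exact_mod_cast le_top)
  have hy : ∀ i, ContDiff ℝ 1 (fun s : LoopState ag => (ag i).h (s.1 i)) := fun i =>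
    ((ag i).h_smooth.of_le (by exact_mod_cast le_top)).comp (contDiff_plant i)
  refine ContDiff.prodMk (contDiff_pi.2 fun i => ?_) (ContDiff.prodMk (contDiff_pi.2 fun i => ?_)
    (ContDiff.prodMk (contDiff_pi.2 fun i => ?_) (contDiff_pi.2 fun i => ?_)))
  · exact (hg i).comp ((contDiff_plant i).prodMk
      (((contDiff_const.mul ((hf i).comp (hy i))).add (contDiff_multiplier i)).add
        ((hus i).comp (hy i))))
  · exact ((((G.contDiff_lap contDiff_multiplier i).neg.sub
      (G.contDiff_lap contDiff_integrator i)).add contDiff_const).sub (hy i)).sub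
        ((contDiff_observer i).dotProduct_const_left _)
  · exact (contDiff_observer i).const_mulVec _
  · exact G.contDiff_lap contDiff_multiplier i

end ObserverError

/-! ### Equilibria of the closed loop -/

section Equilibria

variable {N : ℕ} {G : WeightedGraph N} {ag : Fin N → Agent} {hlo hhi : Fin N → ℝ}
  {xs : ∀ i, ℝ → (ag i).X} {us : Fin N → ℝ → ℝ} {γ : ℝ} {ystar : Fin N → ℝ}

/-- Summing the multiplier equations removes the Laplacians and shows that the outputs are feasible.
The multipliers agree by connectedness and equal `γ` times the marginal costs, so the outputs
satisfy the optimality condition. -/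
theorem IsLoopEquilibrium.eq_regulator (hf : ∀ i, IsStronglyConvexC2 (ag i).f (hlo i) (hhi i))
    (hG : G.toSimpleGraph.Connected) (hreg : ∀ i, (ag i).IsRegulatorSolution (xs i) (us i))
    (hγ : 0 < γ) (hy : IsOptimalAllocation ag ystar) {x : ∀ i, (ag i).X} {lam z : Fin N → ℝ}
    (heq : IsLoopEquilibrium G ag us γ x lam z) (i : Fin N) :
    x i = xs i (ystar i) ∧ lam i = γ * deriv (ag i).f (ystar i) ∧
      G.lap z i = (ag i).d0 - ystar i := by
  have h1 := fun i => (hreg i).eq_of_equilibrium (heq i).1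
  have hlam := WeightedGraph.eq_of_lap_eq_zero hG fun i => (heq i).2.2
  have hsum : ∑ i, (ag i).h (x i) = ∑ i, (ag i).d0 := by
    have h2 : ∑ i, (-G.lap lam i - G.lap z i + (ag i).d0 - (ag i).h (x i)) = 0 :=
      Finset.sum_eq_zero fun i _ => (heq i).2.1
    simp only [Finset.sum_sub_distrib, Finset.sum_add_distrib, Finset.sum_neg_distrib,
      WeightedGraph.sum_lap] at h2
    linarith
  have hyx : ystar = fun i => (ag i).h (x i) := by
    refine hy.eq_of_kkt hf (μ := lam i / γ) hsum fun j => ?_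
    rw [hlam i j, (h1 j).2, mul_div_cancel_left₀ _ hγ.ne']
  have hyi : ystar i = (ag i).h (x i) := congrFun hyx i
  refine ⟨by rw [hyi]; exact (h1 i).1, by rw [hyi]; exact (h1 i).2, ?_⟩
  linarith [(heq i).2.1, (heq i).2.2]

theorem isLoopEquilibrium_of_regulator (hf : ∀ i, IsStronglyConvexC2 (ag i).f (hlo i) (hhi i))
    (hreg : ∀ i, (ag i).IsRegulatorSolution (xs i) (us i)) (hy : IsOptimalAllocation ag ystar)
    {z : Fin N → ℝ} (hz : ∀ i, G.lap z i = (ag i).d0 - ystar i) :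
    IsLoopEquilibrium G ag us γ (fun i => xs i (ystar i))
      (fun i => γ * deriv (ag i).f (ystar i)) z := by
  obtain ⟨μ, hμ⟩ := hy.exists_deriv_eq hf
  intro i
  have hlap : G.lap (fun i => γ * deriv (ag i).f (ystar i)) i = 0 :=
    G.lap_of_const (fun i j => by rw [hμ, hμ]) i
  refine ⟨?_, ?_, hlap⟩
  · have : (ag i).ctrl (us i) γ (xs i (ystar i)) (γ * deriv (ag i).f (ystar i)) =
        us i (ystar i) := by
      rw [Agent.ctrl, (hreg i).output]
      ring
    rw [this]
    exact (hreg i).equilibrium _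
  · rw [hlap, hz, (hreg i).output]
    ring

/-- Only `z` is left free, and only by a constant vector, the kernel of the Laplacian; prescribing
its sum removes this freedom. Solvability for `z` is feasibility of `ystar`. -/
theorem existsUnique_loopEquilibrium (hf : ∀ i, IsStronglyConvexC2 (ag i).f (hlo i) (hhi i))
    (hG : G.toSimpleGraph.Connected) (hreg : ∀ i, (ag i).IsRegulatorSolution (xs i) (us i))
    (hγ : 0 < γ) (hy : IsOptimalAllocation ag ystar) (c : ℝ) :
    ∃! p : (∀ i, (ag i).X) × (Fin N → ℝ) × (Fin N → ℝ),
      IsLoopEquilibrium G ag us γ p.1 p.2.1 p.2.2 ∧ ∑ i, p.2.2 i = c := by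
  have hN : (N : ℝ) ≠ 0 := by
    obtain ⟨i⟩ := hG.nonempty
    exact_mod_cast (Fin.pos i).ne'
  obtain ⟨v, hv, hvs⟩ := WeightedGraph.exists_lap_eq hG
    (w := fun i => (ag i).d0 - ystar i) (by rw [Finset.sum_sub_distrib, hy.1, sub_self])
  have hz : ∀ i, G.lap (v + fun _ => c / N) i = (ag i).d0 - ystar i := fun i => by
    rw [G.lap_add, G.lap_of_const (v := fun _ => c / N) (fun _ _ => rfl), add_zero, hv]
  have hzs : ∑ i, (v + fun _ => c / N : Fin N → ℝ) i = c := by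
    simp [Finset.sum_add_distrib, hvs, mul_div_cancel₀ _ hN]
  refine ⟨(fun i => xs i (ystar i), fun i => γ * deriv (ag i).f (ystar i), v + fun _ => c / N),
    ⟨isLoopEquilibrium_of_regulator hf hreg hy hz, hzs⟩, ?_⟩
  rintro ⟨x, lam, z⟩ ⟨heq, hs⟩
  have h := heq.eq_regulator hf hG hreg hγ hy
  refine Prod.ext (funext fun i => (h i).1) (Prod.ext (funext fun i => (h i).2.1) ?_)
  refine sub_eq_zero.1 (WeightedGraph.eq_zero_of_lap_eq_zero hG (v := z - (v + fun _ => c / N))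
    (fun i => ?_) ?_)
  · rw [G.lap_sub, hz, (h i).2.2, sub_self]
  · simp only [Pi.sub_apply, Finset.sum_sub_distrib]
    rw [hzs]
    exact sub_eq_zero.2 hs

end Equilibria

/-! ### The storage function of the closed loop -/

section LoopLyapunov

open Matrix

variable {N : ℕ}

/-- The quotient `p / q` is bounded on the compact unit sphere, and homogeneity extends the bound.
It supplies the weight needed to absorb all terms quadratic in the observer error. -/
theorem exists_bound_of_homogeneous {W : Type*} [NormedAddCommGroup W] [NormedSpace ℝ W]
    [FiniteDimensional ℝ W] {p q : W → ℝ} (hp : Continuous p) (hq : Continuous q)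
    (hp2 : ∀ (c : ℝ) w, p (c • w) = c ^ 2 * p w) (hq2 : ∀ (c : ℝ) w, q (c • w) = c ^ 2 * q w)
    (hpos : ∀ w, w ≠ 0 → 0 < q w) : ∃ C, 0 ≤ C ∧ ∀ w, p w ≤ C * q w := by
  have := FiniteDimensional.proper_real W
  have hne : ∀ w ∈ Metric.sphere (0 : W) 1, q w ≠ 0 := fun w hw =>
    (hpos w (ne_zero_of_mem_unit_sphere ⟨w, hw⟩)).ne'
  obtain ⟨C, hC⟩ := (isCompact_sphere (0 : W) 1).exists_bound_of_continuousOn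
    (hp.continuousOn.div hq.continuousOn hne)
  refine ⟨max C 0, le_max_right _ _, fun w => ?_⟩
  by_cases hw : w = 0
  · have h1 := hp2 0 0
    have h2 := hq2 0 0
    simp only [smul_zero] at h1 h2
    rw [hw, h1, h2]
    simp
  · have hn : ‖w‖ ≠ 0 := norm_ne_zero_iff.2 hw
    set v := ‖w‖⁻¹ • w with hv
    have hvs : v ∈ Metric.sphere (0 : W) 1 := by
      rw [mem_sphere_zero_iff_norm, hv, norm_smul, norm_inv, norm_norm, inv_mul_cancel₀ hn]
    have hwv : w = ‖w‖ • v := by rw [hv, smul_smul, mul_inv_cancel₀ hn, one_smul]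
    have hqv : 0 < q v := hpos v (ne_zero_of_mem_unit_sphere ⟨v, hvs⟩)
    have h1 : p v ≤ max C 0 * q v := by
      rw [← div_le_iff₀ hqv]
      exact ((le_abs_self _).trans (hC v hvs)).trans (le_max_left _ _)
    rw [hwv, hp2, hq2]
    nlinarith [mul_le_mul_of_nonneg_left h1 (sq_nonneg ‖w‖)]

variable (G : WeightedGraph N) {ag : Fin N → Agent}

/-- Storage functions of the plants, plus squared distances of the multipliers and integrators
from observer-dependent references, plus a quadratic form of the observer error. -/
noncomputable def loopLyapunov (V : ∀ i, (ag i).X → ℝ) (lam₀ z₀ : Fin N → ℝ)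
    (c c' : ∀ i, ObsIdx (ag i).k → ℝ)
    (Q : ∀ i, Matrix (ObsIdx (ag i).k) (ObsIdx (ag i).k) ℝ) (k : ℝ) (s : LoopState ag) : ℝ :=
  ∑ i, V i (s.1 i) + 1 / 2 * ∑ i, (s.2.1 i - lam₀ i - c i ⬝ᵥ s.2.2.1 i) ^ 2 +
    1 / 2 * ∑ i, (s.2.2.2 i - z₀ i - G.lap (fun j => c' j ⬝ᵥ s.2.2.1 j) i) ^ 2 +
    k * ∑ i, s.2.2.1 i ⬝ᵥ Q i *ᵥ s.2.2.1 i

variable {G} {V : ∀ i, (ag i).X → ℝ} {lam₀ z₀ : Fin N → ℝ} {c c' : ∀ i, ObsIdx (ag i).k → ℝ}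
  {Q : ∀ i, Matrix (ObsIdx (ag i).k) (ObsIdx (ag i).k) ℝ} {k : ℝ}

theorem differentiable_loopLyapunov (hV : ∀ i, Differentiable ℝ (V i)) :
    Differentiable ℝ (loopLyapunov G V lam₀ z₀ c c' Q k) := by
  have h1 : ∀ i, Differentiable ℝ (fun s : LoopState ag => V i (s.1 i)) := fun i =>
    (hV i).comp ((contDiff_plant (n := 1) i).differentiable one_ne_zero)
  have h2 : ContDiff ℝ 1 (fun s : LoopState ag =>
      1 / 2 * ∑ i, (s.2.1 i - lam₀ i - c i ⬝ᵥ s.2.2.1 i) ^ 2) :=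
    contDiff_const.mul (ContDiff.sum fun i _ => (((contDiff_multiplier i).sub contDiff_const).sub
      ((contDiff_observer i).dotProduct_const_left _)).pow 2)
  have h3 : ContDiff ℝ 1 (fun s : LoopState ag =>
      1 / 2 * ∑ i, (s.2.2.2 i - z₀ i - G.lap (fun j => c' j ⬝ᵥ s.2.2.1 j) i) ^ 2) :=
    contDiff_const.mul (ContDiff.sum fun i _ => (((contDiff_integrator i).sub contDiff_const).sub
      (G.contDiff_lap (fun j => (contDiff_observer j).dotProduct_const_left _) i)).pow 2)
  have h4 : ContDiff ℝ 1 (fun s : LoopState ag => k * ∑ i, s.2.2.1 i ⬝ᵥ Q i *ᵥ s.2.2.1 i) :=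
    contDiff_const.mul (ContDiff.sum fun i _ => ContDiff.sum fun j _ =>
      (contDiff_pi.1 (contDiff_observer i) j).mul
        (contDiff_pi.1 ((contDiff_observer i).const_mulVec (Q i)) j))
  exact (((Differentiable.fun_sum fun i _ => h1 i).add (h2.differentiable one_ne_zero)).add
    (h3.differentiable one_ne_zero)).add (h4.differentiable one_ne_zero)

theorem hasDerivAt_affine_sq (a b : ℝ) :
    HasDerivAt (fun t : ℝ => (a + t * b) ^ 2) (2 * a * b) 0 := by
  simpa using (((hasDerivAt_id (0 : ℝ)).mul_const b).const_add a).fun_pow 2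

/-- By differentiability it is enough to differentiate along the line `t ↦ s + t • v`, where every
term except the storage functions is a quadratic polynomial in `t`. -/
theorem fderiv_loopLyapunov (hV : ∀ i, Differentiable ℝ (V i)) (s v : LoopState ag) :
    fderiv ℝ (loopLyapunov G V lam₀ z₀ c c' Q k) s v =
      ∑ i, fderiv ℝ (V i) (s.1 i) (v.1 i) +
      ∑ i, (s.2.1 i - lam₀ i - c i ⬝ᵥ s.2.2.1 i) * (v.2.1 i - c i ⬝ᵥ v.2.2.1 i) +
      ∑ i, (s.2.2.2 i - z₀ i - G.lap (fun j => c' j ⬝ᵥ s.2.2.1 j) i) *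
        (v.2.2.2 i - G.lap (fun j => c' j ⬝ᵥ v.2.2.1 j) i) +
      k * ∑ i, (s.2.2.1 i ⬝ᵥ Q i *ᵥ v.2.2.1 i + v.2.2.1 i ⬝ᵥ Q i *ᵥ s.2.2.1 i) := by
  have hline : ∀ {W : Type} [NormedAddCommGroup W] [NormedSpace ℝ W] (p w : W),
      HasDerivAt (fun t : ℝ => p + t • w) w 0 := fun p w => by
    simpa using ((hasDerivAt_id (0 : ℝ)).smul_const w).const_add p
  have hcomp : ∀ {W : Type} [NormedAddCommGroup W] [NormedSpace ℝ W] {f : W → ℝ},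
      Differentiable ℝ f → ∀ p w : W,
        HasDerivAt (fun t : ℝ => f (p + t • w)) (fderiv ℝ f p w) 0 := fun {W} _ _ {f} hf p w => by
    have h1 : HasFDerivAt f (fderiv ℝ f p) (p + (0 : ℝ) • w) := by
      rw [zero_smul, add_zero]
      exact (hf p).hasFDerivAt
    exact h1.comp_hasDerivAt 0 (hline p w)
  refine (hcomp (differentiable_loopLyapunov hV) s v).unique ?_
  have h1 := HasDerivAt.fun_sum (u := Finset.univ) fun i _ => hcomp (hV i) (s.1 i) (v.1 i)
  have h2 : HasDerivAt (fun t : ℝ => 1 / 2 * ∑ i, ((s + t • v).2.1 i - lam₀ i -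
      c i ⬝ᵥ (s + t • v).2.2.1 i) ^ 2)
      (∑ i, (s.2.1 i - lam₀ i - c i ⬝ᵥ s.2.2.1 i) * (v.2.1 i - c i ⬝ᵥ v.2.2.1 i)) 0 := by
    have h := (HasDerivAt.fun_sum (u := Finset.univ) fun i _ =>
      hasDerivAt_affine_sq (s.2.1 i - lam₀ i - c i ⬝ᵥ s.2.2.1 i)
        (v.2.1 i - c i ⬝ᵥ v.2.2.1 i)).const_mul (1 / 2)
    refine (h.congr_deriv ?_).congr_of_eventuallyEq (Eventually.of_forall fun t => ?_)
    · rw [Finset.mul_sum]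
      exact Finset.sum_congr rfl fun i _ => by ring
    · refine congrArg (1 / 2 * ·) ?_
      refine Finset.sum_congr rfl fun i _ => ?_
      simp only [Prod.snd_add, Prod.fst_add, Prod.smul_snd, Prod.smul_fst, Pi.add_apply,
        Pi.smul_apply, dotProduct_add, dotProduct_smul, smul_eq_mul]
      ring
  have h3 : HasDerivAt (fun t : ℝ => 1 / 2 * ∑ i, ((s + t • v).2.2.2 i - z₀ i -
      G.lap (fun j => c' j ⬝ᵥ (s + t • v).2.2.1 j) i) ^ 2)
      (∑ i, (s.2.2.2 i - z₀ i - G.lap (fun j => c' j ⬝ᵥ s.2.2.1 j) i) *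
        (v.2.2.2 i - G.lap (fun j => c' j ⬝ᵥ v.2.2.1 j) i)) 0 := by
    have h := (HasDerivAt.fun_sum (u := Finset.univ) fun i _ =>
      hasDerivAt_affine_sq (s.2.2.2 i - z₀ i - G.lap (fun j => c' j ⬝ᵥ s.2.2.1 j) i)
        (v.2.2.2 i - G.lap (fun j => c' j ⬝ᵥ v.2.2.1 j) i)).const_mul (1 / 2)
    refine (h.congr_deriv ?_).congr_of_eventuallyEq (Eventually.of_forall fun t => ?_)
    · rw [Finset.mul_sum]
      exact Finset.sum_congr rfl fun i _ => by ring
    · refine congrArg (1 / 2 * ·) ?_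
      refine Finset.sum_congr rfl fun i _ => ?_
      have hlap : G.lap (fun j => c' j ⬝ᵥ (s + t • v).2.2.1 j) i =
          G.lap (fun j => c' j ⬝ᵥ s.2.2.1 j) i + t * G.lap (fun j => c' j ⬝ᵥ v.2.2.1 j) i := by
        rw [← G.lap_smul, ← G.lap_add]
        congr 1
        funext j
        simp only [Prod.snd_add, Prod.fst_add, Prod.smul_snd, Prod.smul_fst, Pi.add_apply,
          Pi.smul_apply, dotProduct_add, dotProduct_smul, smul_eq_mul]
      rw [hlap]
      simp only [Prod.snd_add, Prod.smul_snd, Pi.add_apply, Pi.smul_apply, smul_eq_mul]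
      ring
  have h4 : HasDerivAt (fun t : ℝ => k * ∑ i, (s + t • v).2.2.1 i ⬝ᵥ Q i *ᵥ (s + t • v).2.2.1 i)
      (k * ∑ i, (s.2.2.1 i ⬝ᵥ Q i *ᵥ v.2.2.1 i + v.2.2.1 i ⬝ᵥ Q i *ᵥ s.2.2.1 i)) 0 := by
    refine HasDerivAt.const_mul k (HasDerivAt.fun_sum fun i _ => ?_)
    have h : ∀ a b d : ℝ, HasDerivAt (fun t : ℝ => a + t * b + t ^ 2 * d) b 0 := fun a b d => by
      simpa using (((hasDerivAt_id (0 : ℝ)).mul_const b).const_add a).fun_add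
        (((hasDerivAt_id (0 : ℝ)).fun_pow 2).mul_const d)
    refine (h (s.2.2.1 i ⬝ᵥ Q i *ᵥ s.2.2.1 i) _
      (v.2.2.1 i ⬝ᵥ Q i *ᵥ v.2.2.1 i)).congr_of_eventuallyEq (Eventually.of_forall fun t => ?_)
    simp only [Prod.snd_add, Prod.fst_add, Prod.smul_snd, Prod.smul_fst, Pi.add_apply,
      Pi.smul_apply, dotProduct_add, add_dotProduct, Matrix.mulVec_add, Matrix.mulVec_smul,
      dotProduct_smul, smul_dotProduct, smul_eq_mul]
    ring
  exact ((h1.add h2).add h3).add h4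

theorem IsClassKInf.nonneg {α : ℝ → ℝ} (hα : IsClassKInf α) {t : ℝ} (ht : 0 ≤ t) : 0 ≤ α t := by
  rw [← hα.map_zero]
  exact hα.strictMonoOn.monotoneOn self_mem_Ici ht ht

theorem IsClassKInf.eq_zero {α : ℝ → ℝ} (hα : IsClassKInf α) {t : ℝ} (ht : 0 ≤ t)
    (h : α t ≤ 0) : t = 0 := by
  by_contra hne
  have := hα.strictMonoOn self_mem_Ici ht (lt_of_le_of_ne ht (Ne.symm hne))
  rw [hα.map_zero] at this
  linarith

section Properties

variable {x₀ : ∀ i, (ag i).X} {α : Fin N → ℝ → ℝ}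

/-- All summands are nonnegative, so each is controlled by the total; positive definiteness and
properness both follow from these bounds. -/
theorem loopLyapunov_terms_le (hV0 : ∀ i x, 0 ≤ V i x) (hk : 1 ≤ k)
    (hQ : ∀ i v, v ⬝ᵥ v ≤ v ⬝ᵥ Q i *ᵥ v) (s : LoopState ag) (i : Fin N) :
    V i (s.1 i) ≤ loopLyapunov G V lam₀ z₀ c c' Q k s ∧
    (s.2.1 i - lam₀ i - c i ⬝ᵥ s.2.2.1 i) ^ 2 ≤ 2 * loopLyapunov G V lam₀ z₀ c c' Q k s ∧
    (s.2.2.2 i - z₀ i - G.lap (fun j => c' j ⬝ᵥ s.2.2.1 j) i) ^ 2 ≤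
      2 * loopLyapunov G V lam₀ z₀ c c' Q k s ∧
    s.2.2.1 i ⬝ᵥ s.2.2.1 i ≤ loopLyapunov G V lam₀ z₀ c c' Q k s := by
  have hself : ∀ i, 0 ≤ s.2.2.1 i ⬝ᵥ s.2.2.1 i := fun i =>
    Finset.sum_nonneg fun j _ => mul_self_nonneg _
  have hq : ∀ i, 0 ≤ s.2.2.1 i ⬝ᵥ Q i *ᵥ s.2.2.1 i := fun i => (hself i).trans (hQ i _)
  have h1 := Finset.single_le_sum (f := fun i => V i (s.1 i)) (fun i _ => hV0 i _)
    (Finset.mem_univ i)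
  have h2 := Finset.single_le_sum (f := fun i => (s.2.1 i - lam₀ i - c i ⬝ᵥ s.2.2.1 i) ^ 2)
    (fun i _ => sq_nonneg _) (Finset.mem_univ i)
  have h3 := Finset.single_le_sum
    (f := fun i => (s.2.2.2 i - z₀ i - G.lap (fun j => c' j ⬝ᵥ s.2.2.1 j) i) ^ 2)
    (fun i _ => sq_nonneg _) (Finset.mem_univ i)
  have h4 := Finset.single_le_sum (f := fun i => s.2.2.1 i ⬝ᵥ Q i *ᵥ s.2.2.1 i)
    (fun i _ => hq i) (Finset.mem_univ i)
  have n1 := hV0 i (s.1 i)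
  have n2 := sq_nonneg (s.2.1 i - lam₀ i - c i ⬝ᵥ s.2.2.1 i)
  have n3 := sq_nonneg (s.2.2.2 i - z₀ i - G.lap (fun j => c' j ⬝ᵥ s.2.2.1 j) i)
  have n4 := hQ i (s.2.2.1 i)
  have n5 := hself i
  have h5 : ∑ i, s.2.2.1 i ⬝ᵥ Q i *ᵥ s.2.2.1 i ≤ k * ∑ i, s.2.2.1 i ⬝ᵥ Q i *ᵥ s.2.2.1 i :=
    le_mul_of_one_le_left (by linarith) hk
  unfold loopLyapunov
  refine ⟨?_, ?_, ?_, ?_⟩ <;> linarith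

theorem loopLyapunov_pos (hα : ∀ i, IsClassKInf (α i)) (hVα : ∀ i x, α i ‖x - x₀ i‖ ≤ V i x)
    (hk : 1 ≤ k) (hQ : ∀ i v, v ⬝ᵥ v ≤ v ⬝ᵥ Q i *ᵥ v) {s : LoopState ag}
    (hs : s ≠ (x₀, lam₀, 0, z₀)) : 0 < loopLyapunov G V lam₀ z₀ c c' Q k s := by
  by_contra! hle
  apply hs
  have h := loopLyapunov_terms_le (G := G) (lam₀ := lam₀) (z₀ := z₀) (c := c) (c' := c')
    (fun i x => ((hα i).nonneg (norm_nonneg _)).trans (hVα i x)) hk hQ s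
  have hx : s.1 = x₀ := funext fun i => by
    have := (hα i).eq_zero (norm_nonneg _) ((hVα i _).trans ((h i).1.trans hle))
    exact sub_eq_zero.1 (norm_eq_zero.1 this)
  have he : s.2.2.1 = 0 := funext fun i => by
    have h1 : s.2.2.1 i ⬝ᵥ s.2.2.1 i = 0 := le_antisymm ((h i).2.2.2.trans hle)
      (Finset.sum_nonneg fun j _ => mul_self_nonneg _)
    exact dotProduct_self_eq_zero.1 h1
  have hl : s.2.1 = lam₀ := funext fun i => by
    have h1 := pow_eq_zero_iff two_ne_zero |>.1
      (le_antisymm ((h i).2.1.trans (by linarith)) (sq_nonneg _))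
    simp only [he, Pi.zero_apply, dotProduct_zero] at h1
    linarith
  have hz : s.2.2.2 = z₀ := funext fun i => by
    have h1 := pow_eq_zero_iff two_ne_zero |>.1
      (le_antisymm ((h i).2.2.1.trans (by linarith)) (sq_nonneg _))
    simp only [he, Pi.zero_apply, dotProduct_zero] at h1
    rw [G.lap_of_const (v := fun _ => 0) (fun _ _ => rfl)] at h1
    linarith
  exact Prod.ext hx (Prod.ext hl (Prod.ext he hz))

theorem isBounded_loopLyapunov_le (hα : ∀ i, IsClassKInf (α i))
    (hVα : ∀ i x, α i ‖x - x₀ i‖ ≤ V i x) (hk : 1 ≤ k) (hQ : ∀ i v, v ⬝ᵥ v ≤ v ⬝ᵥ Q i *ᵥ v)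
    (b : ℝ) : Bornology.IsBounded {s | loopLyapunov G V lam₀ z₀ c c' Q k s ≤ b} := by
  -- `Ψ` undoes the shift of references by the observer error. Sublevel sets are bounded in the
  -- shifted coordinates, hence lie in the image of a compact ball under `Ψ`.
  let Ψ : LoopState ag → LoopState ag := fun s =>
    (s.1, fun i => s.2.1 i + lam₀ i + c i ⬝ᵥ s.2.2.1 i, s.2.2.1,
      fun i => s.2.2.2 i + z₀ i + G.lap (fun j => c' j ⬝ᵥ s.2.2.1 j) i)
  have hΨ : ContDiff ℝ 1 Ψ :=
    ContDiff.prodMk contDiff_fst (ContDiff.prodMk (contDiff_pi.2 fun i =>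
      ((contDiff_multiplier i).add contDiff_const).add
        ((contDiff_observer i).dotProduct_const_left _))
      (ContDiff.prodMk (contDiff_fst.comp (contDiff_snd.comp contDiff_snd))
      (contDiff_pi.2 fun i => ((contDiff_integrator i).add contDiff_const).add
        (G.contDiff_lap (fun j => (contDiff_observer j).dotProduct_const_left _) i))))
  have hr : ∀ i, ∃ r, ∀ t, r ≤ t → b + 1 ≤ α i t := fun i =>
    eventually_atTop.1 ((tendsto_atTop.1 (hα i).tendsto_atTop) (b + 1))
  choose r hr using hr
  set ρ : ℝ := ∑ i, (‖x₀ i‖ + |r i|) + (2 * |b| + 1) with hρ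
  have hx0 : ∀ i, 0 ≤ ‖x₀ i‖ + |r i| := fun i => by positivity
  have hρ1 : 2 * |b| + 1 ≤ ρ := by
    have := Finset.sum_nonneg fun i (_ : i ∈ Finset.univ) => hx0 i
    linarith
  have hρ2 : ∀ i, ‖x₀ i‖ + |r i| ≤ ρ := fun i => by
    have := Finset.single_le_sum (f := fun i => ‖x₀ i‖ + |r i|) (fun i _ => hx0 i)
      (Finset.mem_univ i)
    have := abs_nonneg b
    linarith
  have hρ0 : 0 ≤ ρ := by linarith [abs_nonneg b]
  have hsq : ∀ a : ℝ, a ^ 2 ≤ 2 * b → ‖a‖ ≤ ρ := fun a ha => by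
    rw [Real.norm_eq_abs]
    refine le_trans ?_ hρ1
    by_contra! h
    have := sq_abs a
    nlinarith [le_abs_self b, abs_nonneg b]
  have hcpt : IsCompact (Metric.closedBall (0 : LoopState ag) ρ) := isCompact_closedBall 0 ρ
  refine (hcpt.image hΨ.continuous).isBounded.subset fun s hs => ?_
  have hs : loopLyapunov G V lam₀ z₀ c c' Q k s ≤ b := hs
  have h := loopLyapunov_terms_le (G := G) (lam₀ := lam₀) (z₀ := z₀) (c := c) (c' := c')
    (fun i x => ((hα i).nonneg (norm_nonneg _)).trans (hVα i x)) hk hQ s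
  refine ⟨(s.1, fun i => s.2.1 i - lam₀ i - c i ⬝ᵥ s.2.2.1 i, s.2.2.1,
    fun i => s.2.2.2 i - z₀ i - G.lap (fun j => c' j ⬝ᵥ s.2.2.1 j) i), ?_, ?_⟩
  · rw [mem_closedBall_zero_iff]
    simp only [norm_prod_le_iff]
    refine ⟨?_, ?_, ?_, ?_⟩ <;> rw [pi_norm_le_iff_of_nonneg hρ0] <;> intro i
    · refine le_trans ?_ (hρ2 i)
      have h1 : ‖s.1 i - x₀ i‖ ≤ |r i| := by
        by_contra! h1
        linarith [hr i _ ((le_abs_self _).trans h1.le), hVα i (s.1 i), (h i).1]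
      have h2 := norm_add_le (x₀ i) (s.1 i - x₀ i)
      rw [add_sub_cancel] at h2
      linarith
    · exact hsq _ ((h i).2.1.trans (by linarith))
    · rw [pi_norm_le_iff_of_nonneg hρ0]
      intro j
      apply hsq
      have h1 := Finset.single_le_sum (f := fun j => s.2.2.1 i j * s.2.2.1 i j)
        (fun j _ => mul_self_nonneg _) (Finset.mem_univ j)
      have h2 := (h i).2.2.2
      have h3 := mul_self_nonneg (s.2.2.1 i j)
      simp only [dotProduct] at h1 h2
      rw [sq]
      linarith
    · exact hsq _ ((h i).2.2.1.trans (by linarith))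
  · refine Prod.ext rfl (Prod.ext (funext fun i => ?_) (Prod.ext rfl (funext fun i => ?_)))
    · simp only [Ψ]; ring
    · simp only [Ψ]; ring

end Properties

end LoopLyapunov

/-! ### The dissipation inequality -/

section Dissipation

open Matrix

/-- The dissipation inequality of a passive plant under the optimal-allocation feedback. -/
theorem Agent.mul_ctrl_sub_le {A : Agent} {lo hi : ℝ} (hf : IsStronglyConvexC2 A.f lo hi)
    {us : ℝ → ℝ} {M : ℝ≥0} (hM : LipschitzWith M us) {γ : ℝ} (hγ : (1 + (M : ℝ)) / lo < γ)
    (x : A.X) (lam r : ℝ) :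
    (A.h x - r) * (A.ctrl us γ x lam - us r) ≤
      -(A.h x - r) ^ 2 + (A.h x - r) * (lam - γ * deriv A.f r) := by
  have h1 : 1 + (M : ℝ) < γ * lo := (div_lt_iff₀ hf.lo_pos).1 hγ
  have hγ0 : 0 < γ := lt_of_le_of_lt (div_nonneg (by positivity) hf.lo_pos.le) hγ
  have h2 := mul_le_mul_of_nonneg_left (hf.mul_sq_le (A.h x) r) hγ0.le
  have h3 : (A.h x - r) * (us (A.h x) - us r) ≤ M * (A.h x - r) ^ 2 := by
    have h4 := hM.dist_le_mul (A.h x) r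
    rw [Real.dist_eq, Real.dist_eq] at h4
    calc (A.h x - r) * (us (A.h x) - us r) ≤ |A.h x - r| * |us (A.h x) - us r| := by
          rw [← abs_mul]
          exact le_abs_self _
      _ ≤ |A.h x - r| * (M * |A.h x - r|) := mul_le_mul_of_nonneg_left h4 (abs_nonneg _)
      _ = M * (A.h x - r) ^ 2 := by rw [← sq_abs (A.h x - r)]; ring
  rw [Agent.ctrl]
  -- Strong convexity gives `-γ * lo` and the Lipschitz bound gives `M` as coefficients of the
  -- squared output error; their sum is below `-1`.
  nlinarith [mul_nonneg (sub_nonneg.2 h1.le) (sq_nonneg (A.h x - r))]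

variable {N : ℕ}

/-- `U` is a proper Lyapunov function of the closed loop in observer error coordinates, positive
definite with respect to `p`, whose dissipation rate `R` detects the output error, the observer
error and the disagreement of the multipliers. -/
structure IsLoopLyapunov (G : WeightedGraph N) (ag : Fin N → Agent) (us : Fin N → ℝ → ℝ) (γ : ℝ)
    (L : ∀ i, ObsIdx (ag i).k → ℝ) (ystar : Fin N → ℝ) (p : LoopState ag)
    (U R : LoopState ag → ℝ) : Prop where
  differentiable : Differentiable ℝ U
  map_self : U p = 0
  pos : ∀ s, s ≠ p → 0 < U s
  isBounded : ∀ b, Bornology.IsBounded {s | U s ≤ b}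
  rate_nonneg : ∀ s, 0 ≤ R s
  fderiv_le : ∀ s, fderiv ℝ U s (observerErrorLoop G ag us γ L s) ≤ -R s
  output_eq : ∀ s, R s = 0 → ∀ i, (ag i).h (s.1 i) = ystar i
  observer_eq : ∀ s, R s = 0 → s.2.2.1 = 0
  multiplier_eq : ∀ s, R s = 0 → ∀ i j, s.2.1 i = s.2.1 j

theorem IsLoopLyapunov.nonneg {G : WeightedGraph N} {ag : Fin N → Agent} {us : Fin N → ℝ → ℝ}
    {γ : ℝ} {L : ∀ i, ObsIdx (ag i).k → ℝ} {ystar : Fin N → ℝ} {p : LoopState ag}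
    {U R : LoopState ag → ℝ} (hU : IsLoopLyapunov G ag us γ L ystar p U R) (s : LoopState ag) :
    0 ≤ U s := by
  by_cases h : s = p
  · rw [h, hU.map_self]
  · exact (hU.pos s h).le

variable {G : WeightedGraph N} {ag : Fin N → Agent} {hlo hhi : Fin N → ℝ}
  {xs : ∀ i, ℝ → (ag i).X} {us : Fin N → ℝ → ℝ} {M : Fin N → ℝ≥0} {γ : ℝ}
  {L : ∀ i, ObsIdx (ag i).k → ℝ} {ystar : Fin N → ℝ}

theorem exists_isLoopLyapunov (hf : ∀ i, IsStronglyConvexC2 (ag i).f (hlo i) (hhi i))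
    (hG : G.toSimpleGraph.Connected)
    (hreg : ∀ i, (ag i).IsRegulatorSolution (xs i) (us i)) (hM : ∀ i, LipschitzWith (M i) (us i))
    (hγ : ∀ i, (1 + (M i : ℝ)) / hlo i < γ) (hL : ∀ i, IsHurwitz ((ag i).obsMatrix (L i)))
    (hpass : ∀ i, (ag i).IsPassiveAt (xs i (ystar i)) (us i (ystar i)))
    {x₀ : ∀ i, (ag i).X} {lam₀ z₀ : Fin N → ℝ} (hx₀ : ∀ i, x₀ i = xs i (ystar i))
    (hlam₀ : ∀ i, lam₀ i = γ * deriv (ag i).f (ystar i)) (hlap : ∀ i, G.lap lam₀ i = 0)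
    (hz₀ : ∀ i, G.lap z₀ i = (ag i).d0 - ystar i) :
    ∃ U R, IsLoopLyapunov G ag us γ L ystar (x₀, lam₀, 0, z₀) U R := by
  choose α α' V hα hα' hV hVb hVd using hpass
  choose Q hQ hQd using fun i => (hL i).exists_lyapunov
  -- Along the loop `c · e` has derivative `-Deps · e`, the perturbation of the multiplier equation,
  -- and `c' · e` has derivative `c · e`, the resulting perturbation of the integrator equation
  -- before the Laplacian is applied.
  choose c hc using fun i => (hL i).exists_dotProduct_mulVec_eq (-(ag i).Deps)
  choose c' hc' using fun i => (hL i).exists_dotProduct_mulVec_eq (c i)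
  have hVα : ∀ i x, α i ‖x - x₀ i‖ ≤ V i x := fun i x => by
    rw [hx₀]
    exact (hVb i x).1
  have hV1 : ∀ i, Differentiable ℝ (V i) := fun i => (hV i).differentiable one_ne_zero
  -- The shifts of `lam` and `z` reappear in the multiplier equation together, as `Lap (w e)`.
  let w : (∀ i, ObsIdx (ag i).k → ℝ) → Fin N → ℝ := fun e i =>
    c i ⬝ᵥ e i + G.lap (fun j => c' j ⬝ᵥ e j) i
  have hcd : ∀ (d : ∀ i, ObsIdx (ag i).k → ℝ) i, ContDiff ℝ 0
      (fun e : ∀ i, ObsIdx (ag i).k → ℝ => d i ⬝ᵥ e i) := fun d i =>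
    (contDiff_pi.1 contDiff_id i).dotProduct_const_left (d i)
  have hw : ∀ i, ContDiff ℝ 0 (fun e => w e i) := fun i =>
    (hcd c i).add (G.contDiff_lap (fun j => hcd c' j) i)
  have hwsmul : ∀ (a : ℝ) e, w (a • e) = a • w e := fun a e => by
    have : (fun j => c' j ⬝ᵥ (a • e) j) = a • fun j => c' j ⬝ᵥ e j := by
      funext j
      simp [dotProduct_smul]
    funext i
    have h := G.lap_smul a (fun j => c' j ⬝ᵥ e j) i
    rw [← this] at h
    change c i ⬝ᵥ (a • e) i + G.lap (fun j => c' j ⬝ᵥ (a • e) j) i = a * w e i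
    rw [h, Pi.smul_apply, dotProduct_smul, smul_eq_mul]
    exact (mul_add _ _ _).symm
  obtain ⟨C, hC0, hC⟩ := exists_bound_of_homogeneous
    (p := fun e => 1 / 2 * ∑ i, (c i ⬝ᵥ e i) ^ 2 + 1 / 2 * ∑ i, w e i * G.lap (w e) i)
    (q := fun e : ∀ i, ObsIdx (ag i).k → ℝ => ∑ i, e i ⬝ᵥ e i)
    (((contDiff_const.mul (ContDiff.sum fun i _ => (hcd c i).pow 2)).add
      (contDiff_const.mul (ContDiff.sum fun i _ => (hw i).mul (G.contDiff_lap hw i)))).continuous)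
    (by fun_prop)
    (fun a e => by
      simp only [hwsmul, G.lap_smul, Pi.smul_apply, dotProduct_smul, smul_eq_mul, mul_add,
        Finset.mul_sum]
      congr 1 <;> exact Finset.sum_congr rfl fun i _ => by ring)
    (fun a e => by
      simp only [Pi.smul_apply, dotProduct_smul, smul_dotProduct, smul_eq_mul, Finset.mul_sum]
      exact Finset.sum_congr rfl fun i _ => by ring)
    (fun e he => by
      obtain ⟨i, hi⟩ := Function.ne_iff.1 he
      have hself : ∀ i, 0 ≤ e i ⬝ᵥ e i := fun i => Finset.sum_nonneg fun j _ => mul_self_nonneg _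
      refine Finset.sum_pos' (fun i _ => hself i) ⟨i, Finset.mem_univ i, ?_⟩
      exact lt_of_le_of_ne (hself i) fun h => hi (dotProduct_self_eq_zero.1 h.symm))
  let a : LoopState ag → Fin N → ℝ := fun s i => s.2.1 i - lam₀ i - c i ⬝ᵥ s.2.2.1 i
  -- The part `C` of the weight pays for the cross terms; the remaining `1` is the observer term of
  -- the rate `R`.
  have hk : 1 ≤ C + 1 := by linarith
  have hself : ∀ (s : LoopState ag) i, 0 ≤ s.2.2.1 i ⬝ᵥ s.2.2.1 i := fun s i =>
    Finset.sum_nonneg fun j _ => mul_self_nonneg _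
  let R : LoopState ag → ℝ := fun s => 1 / 2 * ∑ i, ((ag i).h (s.1 i) - ystar i) ^ 2 +
    1 / 2 * ∑ i, a s i * G.lap (a s) i + ∑ i, s.2.2.1 i ⬝ᵥ s.2.2.1 i
  have hR1 : ∀ s : LoopState ag, 0 ≤ ∑ i, ((ag i).h (s.1 i) - ystar i) ^ 2 := fun s =>
    Finset.sum_nonneg fun i _ => sq_nonneg _
  have hR2 : ∀ s, 0 ≤ ∑ i, a s i * G.lap (a s) i := fun s => G.sum_mul_lap_self_nonneg _
  have hR3 : ∀ s : LoopState ag, 0 ≤ ∑ i, s.2.2.1 i ⬝ᵥ s.2.2.1 i := fun s =>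
    Finset.sum_nonneg fun i _ => hself s i
  have hR0 : ∀ s, R s = 0 → s.2.2.1 = 0 := fun s hs => by
    have h1 : ∑ i, s.2.2.1 i ⬝ᵥ s.2.2.1 i = 0 := by
      have : 1 / 2 * ∑ i, ((ag i).h (s.1 i) - ystar i) ^ 2 +
        1 / 2 * ∑ i, a s i * G.lap (a s) i + ∑ i, s.2.2.1 i ⬝ᵥ s.2.2.1 i = 0 := hs
      linarith [hR1 s, hR2 s, hR3 s]
    funext i
    exact dotProduct_self_eq_zero.1
      ((Finset.sum_eq_zero_iff_of_nonneg fun i _ => hself s i).1 h1 i (Finset.mem_univ i))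
  refine ⟨loopLyapunov G V lam₀ z₀ c c' Q (C + 1), R, differentiable_loopLyapunov hV1, ?_,
    fun s hs => loopLyapunov_pos hα hVα hk hQ hs, isBounded_loopLyapunov_le hα hVα hk hQ,
    fun s => ?_, fun s => ?_, fun s hs => ?_, hR0, fun s hs => ?_⟩
  · have hV0 : ∀ i, V i (x₀ i) = 0 := fun i => by
      refine le_antisymm ?_ (((hα i).nonneg (norm_nonneg _)).trans (hVα i _))
      -- The upper class `K∞` bound makes the plant storage vanish at its reference state.
      have := (hVb i (x₀ i)).2
      rwa [hx₀, sub_self, norm_zero, (hα' i).map_zero, ← hx₀] at this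
    have hl0 : ∀ i, G.lap (fun _ => (0 : ℝ)) i = 0 := G.lap_of_const fun _ _ => rfl
    simp [loopLyapunov, hV0, hl0]
  · have := hR1 s
    have := hR2 s
    have := hR3 s
    simp only [R]
    linarith
  · rw [fderiv_loopLyapunov hV1]
    let κ : Fin N → ℝ := fun i => c i ⬝ᵥ s.2.2.1 i
    let ζ : Fin N → ℝ := fun i => c' i ⬝ᵥ s.2.2.1 i
    let b : Fin N → ℝ := fun i => s.2.2.2 i - z₀ i - G.lap ζ i
    let Δ : Fin N → ℝ := fun i => (ag i).h (s.1 i) - ystar i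
    have hlam : s.2.1 = lam₀ + (a s + κ) := by
      funext i
      simp only [a, κ, Pi.add_apply]
      ring
    have hz : s.2.2.2 = z₀ + (b + G.lap ζ) := by
      funext i
      simp only [b, Pi.add_apply]
      ring
    have hws : w s.2.2.1 = κ + G.lap ζ := rfl
    have hκ' : ∀ i, c i ⬝ᵥ (observerErrorLoop G ag us γ L s).2.2.1 i =
        -((ag i).Deps ⬝ᵥ s.2.2.1 i) := fun i => by
      simp only [observerErrorLoop]
      rw [hc, neg_dotProduct]
    have hζ' : (fun i => c' i ⬝ᵥ (observerErrorLoop G ag us γ L s).2.2.1 i) = κ := by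
      funext i
      simp only [observerErrorLoop]
      rw [hc']
    have t1 : ∑ i, fderiv ℝ (V i) (s.1 i) ((observerErrorLoop G ag us γ L s).1 i) ≤
        ∑ i, (-Δ i ^ 2 + Δ i * (a s i + κ i)) := by
      refine Finset.sum_le_sum fun i _ => ?_
      have h1 := hVd i (s.1 i) ((ag i).ctrl (us i) γ (s.1 i) (s.2.1 i))
      rw [(hreg i).output] at h1
      have h2 := (ag i).mul_ctrl_sub_le (hf i) (hM i) (hγ i) (s.1 i) (s.2.1 i) (ystar i)
      rw [← hlam₀ i] at h2
      refine h1.trans (h2.trans (le_of_eq ?_))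
      simp only [Δ, a, κ]
      ring
    have t2 : ∑ i, (s.2.1 i - lam₀ i - c i ⬝ᵥ s.2.2.1 i) *
        ((observerErrorLoop G ag us γ L s).2.1 i -
          c i ⬝ᵥ (observerErrorLoop G ag us γ L s).2.2.1 i) =
        ∑ i, (-(a s i * G.lap (a s) i) - a s i * G.lap b i - a s i * G.lap (w s.2.2.1) i -
          a s i * Δ i) := by
      refine Finset.sum_congr rfl fun i _ => ?_
      rw [hκ' i]
      have h1 : G.lap s.2.1 i = G.lap (a s) i + G.lap κ i := by
        rw [hlam, G.lap_add, G.lap_add, hlap, zero_add]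
      have h2 : G.lap s.2.2.2 i = (ag i).d0 - ystar i + (G.lap b i + G.lap (G.lap ζ) i) := by
        rw [hz, G.lap_add, G.lap_add, hz₀]
      simp only [observerErrorLoop]
      rw [h1, h2, hws, G.lap_add]
      simp only [a, Δ]
      ring
    have t3 : ∑ i, (s.2.2.2 i - z₀ i - G.lap (fun j => c' j ⬝ᵥ s.2.2.1 j) i) *
        ((observerErrorLoop G ag us γ L s).2.2.2 i -
          G.lap (fun j => c' j ⬝ᵥ (observerErrorLoop G ag us γ L s).2.2.1 j) i) =
        ∑ i, b i * G.lap (a s) i := by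
      refine Finset.sum_congr rfl fun i _ => ?_
      rw [hζ']
      have h1 : (observerErrorLoop G ag us γ L s).2.2.2 i = G.lap (a s) i + G.lap κ i := by
        simp only [observerErrorLoop]
        rw [hlam, G.lap_add, G.lap_add, hlap, zero_add]
      rw [h1, add_sub_cancel_right]
    have t4 : ∑ i, (s.2.2.1 i ⬝ᵥ Q i *ᵥ (observerErrorLoop G ag us γ L s).2.2.1 i +
        (observerErrorLoop G ag us γ L s).2.2.1 i ⬝ᵥ Q i *ᵥ s.2.2.1 i) ≤
        -∑ i, s.2.2.1 i ⬝ᵥ s.2.2.1 i := by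
      rw [← Finset.sum_neg_distrib]
      exact Finset.sum_le_sum fun i _ => hQd i (s.2.2.1 i)
    have t5 := mul_le_mul_of_nonneg_left t4 (show 0 ≤ C + 1 by linarith)
    have t6 := hC s.2.2.1
    have t7 := G.neg_sum_mul_lap_le (a s) (w s.2.2.1)
    have t8 : ∑ i, Δ i * κ i ≤ 1 / 2 * ∑ i, Δ i ^ 2 + 1 / 2 * ∑ i, (c i ⬝ᵥ s.2.2.1 i) ^ 2 := by
      rw [Finset.mul_sum, Finset.mul_sum, ← Finset.sum_add_distrib]
      refine Finset.sum_le_sum fun i _ => ?_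
      have := sq_nonneg (Δ i - κ i)
      simp only [κ] at this ⊢
      nlinarith
    have t9 := G.sum_mul_lap_comm (a s) b
    have t10 : ∑ i, a s i * Δ i = ∑ i, Δ i * a s i :=
      Finset.sum_congr rfl fun i _ => mul_comm _ _
    -- The products `Δ * a` from the plants and the multipliers cancel, and so do `a * Lap b` and `b
    -- * Lap a` by symmetry. What is left is `Δ * κ` and `a * Lap w`, which cost half of each
    -- dissipated square plus at most `C` times the squared observer error.
    rw [t2, t3]
    simp only [mul_add, Finset.sum_add_distrib, Finset.sum_sub_distrib,
      Finset.sum_neg_distrib] at t1 ⊢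
    have t11 : R s = 1 / 2 * ∑ i, Δ i ^ 2 + 1 / 2 * ∑ i, a s i * G.lap (a s) i +
      ∑ i, s.2.2.1 i ⬝ᵥ s.2.2.1 i := rfl
    rw [t11]
    simp only [Finset.sum_add_distrib] at t5
    nlinarith
  · have h1 : 1 / 2 * ∑ i, ((ag i).h (s.1 i) - ystar i) ^ 2 +
        1 / 2 * ∑ i, a s i * G.lap (a s) i + ∑ i, s.2.2.1 i ⬝ᵥ s.2.2.1 i = 0 := hs
    have h2 : ∑ i, ((ag i).h (s.1 i) - ystar i) ^ 2 = 0 := by linarith [hR1 s, hR2 s, hR3 s]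
    intro i
    have h3 := (Finset.sum_eq_zero_iff_of_nonneg fun i _ => sq_nonneg _).1 h2 i (Finset.mem_univ i)
    exact sub_eq_zero.1 (pow_eq_zero_iff two_ne_zero |>.1 h3)
  · have h1 : 1 / 2 * ∑ i, ((ag i).h (s.1 i) - ystar i) ^ 2 +
        1 / 2 * ∑ i, a s i * G.lap (a s) i + ∑ i, s.2.2.1 i ⬝ᵥ s.2.2.1 i = 0 := hs
    have h2 : ∑ i, a s i * G.lap (a s) i = 0 := by linarith [hR1 s, hR2 s, hR3 s]
    intro i j
    have h3 := WeightedGraph.eq_of_sum_mul_lap_self_eq_zero hG h2 i j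
    have h4 := WeightedGraph.eq_of_lap_eq_zero hG hlap i j
    simp only [a, hR0 s hs, Pi.zero_apply, dotProduct_zero] at h3
    linarith

end Dissipation

/-! ### Limit trajectories and the main theorem -/

section Convergence

open Matrix

variable {N : ℕ} {G : WeightedGraph N} {ag : Fin N → Agent} {hlo hhi : Fin N → ℝ}
  {xs : ∀ i, ℝ → (ag i).X} {us : Fin N → ℝ → ℝ} {γ : ℝ}
  {L : ∀ i, ObsIdx (ag i).k → ℝ} {ystar : Fin N → ℝ}

theorem steadyMotion_eq_add (x : ∀ i, (ag i).X) (lam z : Fin N → ℝ) (t : ℝ) :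
    steadyMotion ag x lam z t = (x, lam, 0, z) + exoMotion ag t := by
  simp [steadyMotion, exoMotion]

/-- Stability of a steady-state motion thus reduces to stability of a point of the autonomous error
system. -/
theorem dist_steadyMotion (s : LoopState ag) (x : ∀ i, (ag i).X) (lam z : Fin N → ℝ) (t : ℝ) :
    dist s (steadyMotion ag x lam z t) = dist (s - exoMotion ag t) (x, lam, 0, z) := by
  rw [steadyMotion_eq_add, dist_eq_norm, dist_eq_norm]
  congr 1
  abel

theorem sum_integrator_eq {s : ℝ → LoopState ag}
    (hs : IsIntegralCurveOn s (fun _ => observerErrorLoop G ag us γ L) (Ici 0)) {t : ℝ}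
    (ht : 0 ≤ t) : ∑ i, (s t).2.2.2 i = ∑ i, (s 0).2.2.2 i := by
  refine eq_of_hasDerivWithinAt_Ici_zero (f := fun t => ∑ i, (s t).2.2.2 i) (fun t ht => ?_) ht
  have h1 := (hs t ht).hasFDerivWithinAt.snd.snd.snd.hasDerivWithinAt
  have h2 := HasDerivWithinAt.fun_sum fun i (_ : i ∈ Finset.univ) => hasDerivWithinAt_pi.1 h1 i
  refine h2.congr_deriv ?_
  simpa [observerErrorLoop] using G.sum_lap (s t).2.1

/-- Under observability, a trajectory without dissipation rests at the equilibrium. -/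
theorem IsLoopLyapunov.eq_equilibrium {p : LoopState ag} {U R : LoopState ag → ℝ}
    (hU : IsLoopLyapunov G ag us γ L ystar p U R)
    (hreg : ∀ i, (ag i).IsRegulatorSolution (xs i) (us i)) (hy : ∑ i, ystar i = ∑ i, (ag i).d0)
    (hobs : ∀ i, (ag i).IsObservableAt (xs i (ystar i))) {φ : ℝ → LoopState ag}
    (hφ : IsIntegralCurveOn φ (fun _ => observerErrorLoop G ag us γ L) (Ici 0))
    (hR : ∀ t, 0 ≤ t → R (φ t) = 0) (i : Fin N) :
    (φ 0).1 i = xs i (ystar i) ∧ (φ 0).2.1 i = γ * deriv (ag i).f (ystar i) ∧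
      (φ 0).2.2.1 i = 0 ∧ G.lap (φ 0).2.2.2 i = (ag i).d0 - ystar i := by
  have hN : (N : ℝ) ≠ 0 := by exact_mod_cast (Fin.pos i).ne'
  -- The multiplier velocity once dissipation is absent. Agreement of the multipliers at all times
  -- makes its entries equal, while its sum is zero by feasibility.
  let v : ℝ → Fin N → ℝ := fun t i => (ag i).d0 - ystar i - G.lap (φ t).2.2.2 i
  have hdlam : ∀ t, 0 ≤ t → ∀ i, HasDerivWithinAt (fun t => (φ t).2.1 i) (v t i) (Ici 0) t := by
    intro t ht i
    have h1 := (hφ t ht).hasFDerivWithinAt.snd.fst.hasDerivWithinAt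
    refine (hasDerivWithinAt_pi.1 h1 i).congr_deriv ?_
    have h2 : G.lap (φ t).2.1 i = 0 := G.lap_of_const (hU.multiplier_eq _ (hR t ht)) i
    have h3 := hU.output_eq _ (hR t ht) i
    have h4 := hU.observer_eq _ (hR t ht)
    simp [observerErrorLoop, h2, h3, h4, v]
    ring
  have hv : ∀ t, 0 ≤ t → ∀ i, v t i = 0 := by
    intro t ht i
    have h1 : ∀ j, v t j = v t i := fun j => by
      refine (uniqueDiffOn_Ici (0 : ℝ) t ht).eq_deriv _ (hdlam t ht j) ?_
      exact (hdlam t ht i).congr (fun r hr => hU.multiplier_eq _ (hR r hr) j i)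
        (hU.multiplier_eq _ (hR t ht) j i)
    have h2 : ∑ j, v t j = 0 := by
      simp only [v, Finset.sum_sub_distrib, G.sum_lap, hy]
      ring
    rw [Finset.sum_congr rfl fun j _ => h1 j] at h2
    simpa [hN] using h2
  have hlam : ∀ t, 0 ≤ t → (φ t).2.1 i = (φ 0).2.1 i := fun t ht =>
    eq_of_hasDerivWithinAt_Ici_zero (f := fun t => (φ t).2.1 i)
      (fun r hr => hv r hr i ▸ hdlam r hr i) ht
  have hout : ∀ t, 0 ≤ t → (ag i).h ((φ t).1 i) = ystar i := fun t ht =>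
    hU.output_eq _ (hR t ht) i
  set u : ℝ := -γ * deriv (ag i).f (ystar i) + (φ 0).2.1 i + us i (ystar i) with hu
  have hdx : IsIntegralCurveOn (fun t => (φ t).1 i) (fun _ ξ => (ag i).g ξ u) (Ici 0) := by
    intro t ht
    have h1 := (hφ t ht).hasFDerivWithinAt.fst.hasDerivWithinAt
    refine (hasDerivWithinAt_pi.1 h1 i).congr_deriv ?_
    simp [observerErrorLoop, Agent.ctrl, hout t ht, hlam t ht, hu]
  have hx := hobs i u _ hdx fun t ht => by rw [hout t ht, (hreg i).output]
  -- The plant rests at its reference state under the constant input `u`, so uniqueness in the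
  -- regulator equations identifies `u`, and with it the multiplier.
  have hg : (ag i).g (xs i (ystar i)) u = 0 := by
    have h1 := hdx 0 self_mem_Ici
    have h2 : HasDerivWithinAt (fun t => (φ t).1 i) 0 (Ici 0) 0 :=
      (hasDerivWithinAt_const 0 (Ici 0) (xs i (ystar i))).congr (fun t ht => hx t ht)
        (hx 0 le_rfl)
    have h3 := (uniqueDiffOn_Ici (0 : ℝ) 0 self_mem_Ici).eq_deriv _ h1 h2
    simpa only [hx 0 le_rfl] using h3
  have hus := ((hreg i).unique _ _ _ hg ((hreg i).output _)).2
  refine ⟨hx 0 le_rfl, by linarith, congrFun (hU.observer_eq _ (hR 0 le_rfl)) i, ?_⟩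
  have := hv 0 le_rfl i
  simp only [v] at this
  linarith

end Convergence

theorem theorem1 {N : ℕ} (G : WeightedGraph N) (ag : Fin N → Agent)
    (hlo hhi : Fin N → ℝ) (xs : ∀ i, ℝ → (ag i).X) (us : Fin N → ℝ → ℝ) (M : Fin N → ℝ≥0)
    (γ : ℝ) (L : ∀ i, ObsIdx (ag i).k → ℝ)
    (hf : ∀ i, IsStronglyConvexC2 (ag i).f (hlo i) (hhi i))
    (hG : G.toSimpleGraph.Connected)
    (hreg : ∀ i, (ag i).IsRegulatorSolution (xs i) (us i))
    (hM : ∀ i, LipschitzWith (M i) (us i))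
    (hγ : ∀ i, (1 + (M i : ℝ)) / hlo i < γ)
    (hL : ∀ i, IsHurwitz ((ag i).obsMatrix (L i))) :
    (∃! ystar : Fin N → ℝ, IsOptimalAllocation ag ystar) ∧
    ∀ ystar : Fin N → ℝ, IsOptimalAllocation ag ystar →
      (∀ i, (ag i).IsPassiveAt (xs i (ystar i)) (us i (ystar i))) →
      -- every initial state is the start of a trajectory on `[0, ∞)`
      (∀ s₀ : LoopState ag, ∃ s : ℝ → LoopState ag, s 0 = s₀ ∧
        IsIntegralCurveOn s (closedLoop G ag us γ L) (Ici 0)) ∧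
      -- trajectories are bounded and the outputs converge to the optimal allocation
      (∀ s : ℝ → LoopState ag, IsIntegralCurveOn s (closedLoop G ag us γ L) (Ici 0) →
        Bornology.IsBounded (s '' Ici 0) ∧
        ∀ i, Tendsto (fun t => (ag i).h ((s t).1 i)) atTop (𝓝 (ystar i))) ∧
      -- for each value of the conserved quantity there is one equilibrium point
      (∀ c : ℝ, ∃! p : (∀ i, (ag i).X) × (Fin N → ℝ) × (Fin N → ℝ),
        IsLoopEquilibrium G ag us γ p.1 p.2.1 p.2.2 ∧ ∑ i, p.2.2 i = c) ∧
      (∀ (x : ∀ i, (ag i).X) (lam z : Fin N → ℝ), IsLoopEquilibrium G ag us γ x lam z →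
        ∀ i, x i = xs i (ystar i)) ∧
      -- asymptotic stability of the equilibrium points
      ((∀ i, (ag i).IsObservableAt (xs i (ystar i))) →
        ∀ (x : ∀ i, (ag i).X) (lam z : Fin N → ℝ), IsLoopEquilibrium G ag us γ x lam z →
          IsStableMotion (closedLoop G ag us γ L) (steadyMotion ag x lam z) ∧
          IsAttractiveMotionOn (closedLoop G ag us γ L) (zLeaf ag (∑ i, z i))
            (steadyMotion ag x lam z)) := by
  obtain ⟨i₀⟩ := hG.nonempty
  have hγ0 : 0 < γ := lt_of_le_of_lt (div_nonneg (by positivity) (hf i₀).lo_pos.le) (hγ i₀)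
  refine ⟨existsUnique_isOptimalAllocation hf, fun ystar hy hpass => ?_⟩
  have hΦ : ContDiff ℝ 1 (observerErrorLoop G ag us γ L) :=
    contDiff_observerErrorLoop (fun i => (hf i).contDiff_deriv)
      fun i => (hreg i).smooth_u.of_le (by exact_mod_cast le_top)
  have hlyap : ∀ (x : ∀ i, (ag i).X) (lam z : Fin N → ℝ), IsLoopEquilibrium G ag us γ x lam z →
      ∃ U R, IsLoopLyapunov G ag us γ L ystar (x, lam, 0, z) U R := fun x lam z heq => by
    have h := heq.eq_regulator hf hG hreg hγ0 hy
    exact exists_isLoopLyapunov hf hG hreg hM hγ hL hpass (fun i => (h i).1) (fun i => (h i).2.1)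
      (fun i => (heq i).2.2) fun i => (h i).2.2
  have hequil := existsUnique_loopEquilibrium (γ := γ) hf hG hreg hγ0 hy
  -- Any equilibrium serves here: existence, boundedness and output convergence do not depend on the
  -- value of `∑ i, z i`.
  obtain ⟨⟨x₁, lam₁, z₁⟩, ⟨heq₁, -⟩, -⟩ := hequil 0
  obtain ⟨U, R, hU⟩ := hlyap x₁ lam₁ z₁ heq₁
  have hdec : ∀ s, fderiv ℝ U s (observerErrorLoop G ag us γ L s) ≤ 0 := fun s =>
    (hU.fderiv_le s).trans (neg_nonpos.2 (hU.rate_nonneg s))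
  refine ⟨fun s₀ => ?_, fun s hs => ⟨?_, fun i => ?_⟩, hequil, fun x lam z heq i =>
    (heq.eq_regulator hf hG hreg hγ0 hy i).1, fun hobs x lam z heq => ?_⟩
  · obtain ⟨φ, hφ0, hφ⟩ := exists_isIntegralCurveOn_Ici_of_lyapunov hΦ hU.differentiable hdec
      hU.isBounded (s₀ - exoMotion ag 0)
    exact ⟨fun t => φ t + exoMotion ag t, by simp [hφ0], hφ.add_exoMotion⟩
  · have hanti := hs.sub_exoMotion.antitoneOn_comp hU.differentiable hdec
    refine ((hU.isBounded (U (s 0 - exoMotion ag 0))).add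
      (isBounded_range_exoMotion (ag := ag))).subset ?_
    rintro _ ⟨t, ht, rfl⟩
    exact ⟨s t - exoMotion ag t, hanti self_mem_Ici ht ht, exoMotion ag t, ⟨t, rfl⟩,
      sub_add_cancel _ _⟩
  · rw [tendsto_iff_ultrafilter]
    intro F hF
    obtain ⟨φ, hlim, -, hR⟩ := exists_limit_trajectory_of_lyapunov hΦ hU.differentiable hU.nonneg
      hU.rate_nonneg hU.fderiv_le hU.isBounded hs.sub_exoMotion F hF
    have h1 : Continuous fun s : LoopState ag => (ag i).h (s.1 i) :=
      (ag i).h_smooth.continuous.comp (contDiff_plant (n := 0) i).continuous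
    have h2 := (h1.tendsto (φ 0)).comp hlim
    rw [hU.output_eq _ (hR 0 le_rfl) i] at h2
    simpa [Function.comp_def, exoMotion] using h2
  · clear hdec hU
    -- For stability the storage function must be centred at the given equilibrium.
    obtain ⟨U, R, hU⟩ := hlyap x lam z heq
    have hdec : ∀ s, fderiv ℝ U s (observerErrorLoop G ag us γ L s) ≤ 0 := fun s =>
      (hU.fderiv_le s).trans (neg_nonpos.2 (hU.rate_nonneg s))
    -- The radius `1` is arbitrary: the attraction holds on the whole leaf, and closeness is not
    -- used.
    refine ⟨fun ε hε => ?_, 1, one_pos, fun s hs hleaf _ => ?_⟩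
    · obtain ⟨m, hm, hball⟩ := exists_sublevel_subset_ball hU.differentiable.continuous hU.pos
        hU.isBounded hε
      have hnear : ∀ᶠ s in 𝓝 ((x, lam, 0, z) : LoopState ag), U s < m :=
        hU.differentiable.continuous.continuousAt.eventually_lt_const (by rwa [hU.map_self])
      obtain ⟨δ, hδ, hδU⟩ := Metric.eventually_nhds_iff.1 hnear
      refine ⟨δ, hδ, fun s hs h0 t ht => ?_⟩
      rw [dist_steadyMotion] at h0 ⊢
      exact hball _ ((hs.sub_exoMotion.antitoneOn_comp hU.differentiable hdec self_mem_Ici ht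
        ht).trans_lt (hδU h0))
    · simp only [dist_steadyMotion]
      rw [← tendsto_iff_dist_tendsto_zero, tendsto_iff_ultrafilter]
      intro F hF
      have hs' := hs.sub_exoMotion
      obtain ⟨φ, hlim, hφ, hR⟩ := exists_limit_trajectory_of_lyapunov hΦ hU.differentiable
        hU.nonneg hU.rate_nonneg hU.fderiv_le hU.isBounded hs' F hF
      have hφ0 := hU.eq_equilibrium hreg hy.1 hobs hφ hR
      have hreg₀ := heq.eq_regulator hf hG hreg hγ0 hy
      have hsum : ∑ i, (φ 0).2.2.2 i = ∑ i, z i := by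
        have h1 : Continuous fun s : LoopState ag => ∑ i, s.2.2.2 i := by fun_prop
        refine tendsto_nhds_unique ((h1.tendsto (φ 0)).comp hlim) (tendsto_const_nhds.congr' ?_)
        filter_upwards [hF (eventually_ge_atTop 0)] with t ht
        have h2 : ∑ i, (s 0).2.2.2 i = ∑ i, z i := hleaf
        simp only [Function.comp_apply]
        rw [sum_integrator_eq hs' ht, ← h2]
        simp [exoMotion]
      have hz : (φ 0).2.2.2 = z := by
        refine sub_eq_zero.1 (WeightedGraph.eq_zero_of_lap_eq_zero hG
          (v := (φ 0).2.2.2 - z) (fun i => ?_) ?_)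
        · rw [G.lap_sub, (hφ0 i).2.2.2, (hreg₀ i).2.2, sub_self]
        · simp only [Pi.sub_apply, Finset.sum_sub_distrib, hsum, sub_self]
      have hp : φ 0 = (x, lam, 0, z) :=
        Prod.ext (funext fun i => (hφ0 i).1.trans (hreg₀ i).1.symm)
          (Prod.ext (funext fun i => (hφ0 i).2.1.trans (hreg₀ i).2.1.symm)
            (Prod.ext (funext fun i => (hφ0 i).2.2.1) hz))
      rw [← hp]
      exact hlim
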